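/- **The space $X$ and the continuum $E$.** Let $f(t)=t^3/3$, let $Y_0=\{(t,y)\in\mathbb R^2: 0\le t<1,\ 0\le y\le f(t)\}$, and let $Y_1$ be the double of $Y_0$, i.e. two copies (top and bottom) of $Y_0$ glued along $\{y=0\}\cup\{y=f(t)\}$. For $m\ge 1$ and odd $i$ with $1\le i<2^m$, put $t_i^m=i/2^m$ and $\ell_i^m=\min\{2^{-m},f(t_i^m)\}$. Let $I_i^m=\{t_i^m\}\times[0,\ell_i^m]$, a slit in the top copy of $Y_0$. Let $S_i^m$ be the double of the square $[0,2^{-m}]^2$, and let $J_i^m=[0,\ell_i^m]\times\{0\}\subset S_i^m$, a slit on the edge along which (among others) the two copies of the square are glued. Cut the top copy of $Y_0$ along every $I_i^m$ and cut $S_i^m$ along $J_i^m$ (endpoints of slits are not doubled), and glue each of the two sides of $I_i^m$ to one of the two sides of $J_i^m$ by $(t_i^m,y)\mapsto(y,0)$. The result is a surface $Y$, which is given the length metric $d_Y$ induced by the Euclidean metrics of the pieces. Let $X=Y\times(-2,2)$ with the metric $d\big((z,s),(w,s')\big)=\sqrt{d_Y(z,w)^2+|s-s'|^2}$, and let $E=\{z_0\}\times[-1,1]$,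 where $z_0=(0,0)\in Y$ is the cusp point. **The collapsed space.** Let $\widetilde X$ be obtained from $X$ by collapsing $E$ to a point and giving the quotient the induced length metric, and let $h\colon X\to\widetilde X$ be the quotient map. **Modulus.** For a family $\Gamma$ of curves (continuous maps from intervals) in a metric space $Z$, $$\operatorname{Mod}_3\Gamma=\inf_\rho\int_Z\rho^3\,d\mathcal H^3,$$ where the infimum is over all Borel functions $\rho\colon Z\to[0,\infty]$ with $\int_\gamma\rho\,ds\ge 1$ for every locally rectifiable $\gamma\in\Gamma$. (In particular $\operatorname{Mod}_3\Gamma=\infty$ if $\Gamma$ contains a constant curve.) **Proposition.** The map $h$ is continuous and surjective and is not a homeomorphism, but it preserves conformal modulus: $$\operatorname{Mod}_3 h(\Gamma)=\operatorname{Mod}_3\Gamma,\qquad h(\Gamma)=\{h\circ\gamma:\gamma\in\Gamma\},$$ for every family $\Gamma$ of curves in $X$ no nonconstant member of which is contained in $E$. For an arbitrary family $\Gamma$ of curves in $X$, $\operatorname{Mod}_3 h(\Gamma\setminus\Gamma_0)=\operatorname{Mod}_3\Gamma$, where $\Gamma_0$ is the set of the nonconstant curves in $\Gamma$ that are contained in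 $E$. -/

import Mathlib

open Set MeasureTheory
open scoped ENNReal

/-! ### Curves, line integrals and modulus in metric spaces

Metrics are `[0, ∞]`-valued (`EMetricSpace`); all the distances that occur below are in fact
finite. -/

/-- A curve in `Z`: a continuous map from a nonempty interval of any kind (open, closed, half-open,
bounded or not) to `Z`.  The values of `toFun` off `dom` play no role. -/
structure Curve (Z : Type*) [TopologicalSpace Z] where
  dom : Set ℝ
  toFun : ℝ → Z
  dom_nonempty : dom.Nonempty
  dom_ordConnected : dom.OrdConnected
  continuousOn : ContinuousOn toFun dom

namespace Curve

/-- The trace of a curve. -/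
def trace {Z : Type*} [TopologicalSpace Z] (γ : Curve Z) : Set Z := γ.toFun '' γ.dom

/-- A curve is trivial if it is constant. -/
def IsTrivial {Z : Type*} [TopologicalSpace Z] (γ : Curve Z) : Prop := γ.trace.Subsingleton

/-- The image `h ∘ γ` of a curve under a continuous map. -/
def map {Z W : Type*} [TopologicalSpace Z] [TopologicalSpace W] (h : Z → W) (hc : Continuous h)
    (γ : Curve Z) : Curve W where
  dom := γ.dom
  toFun := h ∘ γ.toFun
  dom_nonempty := γ.dom_nonempty
  dom_ordConnected := γ.dom_ordConnected
  continuousOn := hc.comp_continuousOn γ.continuousOn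

/-- A curve is locally rectifiable if each of its compact subcurves has finite length. -/
def IsLocallyRectifiable {Z : Type*} [EMetricSpace Z] (γ : Curve Z) : Prop :=
  LocallyBoundedVariationOn γ.toFun γ.dom

/-- The line integral `∫_γ ρ ds` of a locally rectifiable curve: the supremum over the compact
subcurves `γ|[a,b]` of the integral of `ρ` along the arc length parametrization of `γ|[a,b]`. -/
noncomputable def lineIntegral {Z : Type*} [EMetricSpace Z] (γ : Curve Z) (ρ : Z → ℝ≥0∞) : ℝ≥0∞ :=
  ⨆ (a : ℝ) (b : ℝ) (_ : a ∈ γ.dom) (_ : b ∈ γ.dom) (_ : a ≤ b),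
    ∫⁻ s in Icc (0 : ℝ) (eVariationOn γ.toFun (Icc a b)).toReal,
      ρ (naturalParameterization γ.toFun (Icc a b) a s)

end Curve

/-- A Borel function `ρ : Z → [0, ∞]` is admissible for `Γ` if `∫_γ ρ ds ≥ 1` for all locally
rectifiable `γ ∈ Γ`. -/
def IsAdmissible {Z : Type*} [EMetricSpace Z] [MeasurableSpace Z] (Γ : Set (Curve Z))
    (ρ : Z → ℝ≥0∞) : Prop :=
  Measurable ρ ∧ ∀ γ ∈ Γ, γ.IsLocallyRectifiable → 1 ≤ γ.lineIntegral ρ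

/-- The `p`-modulus of `Γ`, with respect to the Hausdorff `n`-measure. -/
noncomputable def modulus (n p : ℝ) {Z : Type*} [EMetricSpace Z] [MeasurableSpace Z] [BorelSpace Z]
    (Γ : Set (Curve Z)) : ℝ≥0∞ :=
  ⨅ (ρ : Z → ℝ≥0∞) (_ : IsAdmissible Γ ρ), ∫⁻ z, ρ z ^ p ∂(Measure.hausdorffMeasure n)

/-! ### Chain metrics -/

/-- The least total cost of a finite chain from `x` to `y`, if a step from `u` to `v` costs
`c u v`. -/
noncomputable def chainEDist {P : Type*} (c : P → P → ℝ≥0∞) (x y : P) : ℝ≥0∞ :=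
  ⨅ (n : ℕ) (u : ℕ → P) (_ : u 0 = x) (_ : u n = y), ∑ i ∈ Finset.range n, c (u i) (u (i + 1))

theorem chainEDist_self {P : Type*} (c : P → P → ℝ≥0∞) (x : P) : chainEDist c x x = 0 := by
  refine le_antisymm ?_ bot_le
  exact iInf_le_of_le 0 (iInf_le_of_le (fun _ => x) (iInf_le_of_le rfl (iInf_le_of_le rfl
    (by simp))))

theorem chainEDist_comm_le {P : Type*} {c : P → P → ℝ≥0∞} (hc : ∀ x y, c x y = c y x) (x y : P) :
    chainEDist c x y ≤ chainEDist c y x := by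
  refine le_iInf fun n => le_iInf fun u => le_iInf fun h0 => le_iInf fun hn => ?_
  refine iInf_le_of_le n (iInf_le_of_le (fun i => u (n - i)) (iInf_le_of_le (by simpa using hn)
    (iInf_le_of_le (by simpa using h0) ?_)))
  rw [← Finset.sum_range_reflect (fun i => c (u i) (u (i + 1)))]
  refine le_of_eq (Finset.sum_congr rfl fun i hi => ?_)
  rw [Finset.mem_range] at hi
  have h1 : n - (i + 1) = n - 1 - i := by omega
  have h2 : n - i = n - 1 - i + 1 := by omega
  rw [hc]
  change c (u (n - (i + 1))) (u (n - i)) = _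
  rw [h1, h2]

theorem chainEDist_triangle {P : Type*} (c : P → P → ℝ≥0∞) (x y z : P) :
    chainEDist c x z ≤ chainEDist c x y + chainEDist c y z := by
  conv_rhs => simp only [chainEDist]
  simp only [ENNReal.iInf_add, ENNReal.add_iInf]
  refine le_iInf fun m => le_iInf fun v => le_iInf fun hv0 => le_iInf fun hvm =>
    le_iInf fun n => le_iInf fun u => le_iInf fun hu0 => le_iInf fun hun => ?_
  refine iInf_le_of_le (n + m) (iInf_le_of_le (fun i => if i < n then u i else v (i - n))
    (iInf_le_of_le ?_ (iInf_le_of_le (by simpa using hvm) ?_)))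
  · rcases Nat.eq_zero_or_pos n with rfl | hn
    · simp [hv0, ← hun, ← hu0]
    · simp [hn, hu0]
  · rw [Finset.sum_range_add]
    refine add_le_add (le_of_eq (Finset.sum_congr rfl fun i hi => ?_))
      (le_of_eq (Finset.sum_congr rfl fun i _ => ?_))
    · rw [Finset.mem_range] at hi
      rcases Nat.lt_or_ge (i + 1) n with h | h
      · simp [hi, h]
      · have : i + 1 = n := by omega
        simp [hi, this, hv0, hun]
    · simp [Nat.add_assoc]

/-- The pseudometric `chainEDist c`, for a symmetric cost function. -/
@[reducible]
noncomputable def chainPseudoEMetric {P : Type*} (c : P → P → ℝ≥0∞) (hc : ∀ x y, c x y = c y x) :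
    PseudoEMetricSpace P where
  edist := chainEDist c
  edist_self := chainEDist_self c
  edist_comm x y := le_antisymm (chainEDist_comm_le hc x y) (chainEDist_comm_le hc y x)
  edist_triangle := chainEDist_triangle c

/-! ### Collapsing a set to a point -/

/-- The set `Z` with the pseudometric obtained by declaring all points of `E` to be at distance
zero: the infimum of the lengths of finite chains in which jumps within `E` are free. -/
def CollapsePre (Z : Type*) (_E : Set Z) : Type _ := Z

noncomputable instance {Z : Type*} [EMetricSpace Z] (E : Set Z) :
    PseudoEMetricSpace (CollapsePre Z E) :=
  chainPseudoEMetric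
    (fun x y : Z => min (edist x y) (⨅ (_ : x ∈ E ∧ y ∈ E), 0))
    (fun x y => congrArg₂ min (edist_comm (α := Z) x y) (by rw [and_comm]))

/-- The quotient metric space `Z / E`. -/
abbrev CollapseQuotient (Z : Type*) [EMetricSpace Z] (E : Set Z) : Type _ :=
  SeparationQuotient (CollapsePre Z E)

/-- The length metric induced by the metric of `Z`: the infimum of the lengths of the curves
`γ : [a, b] → Z` joining `x` to `y`. -/
noncomputable def lengthEDist {Z : Type*} [EMetricSpace Z] (x y : Z) : ℝ≥0∞ :=
  ⨅ (a : ℝ) (b : ℝ) (γ : ℝ → Z)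
    (_ : a ≤ b ∧ ContinuousOn γ (Icc a b) ∧ γ a = x ∧ γ b = y), eVariationOn γ (Icc a b)

theorem lengthEDist_self {Z : Type*} [EMetricSpace Z] (x : Z) : lengthEDist x x = 0 := by
  refine le_antisymm ?_ bot_le
  refine iInf_le_of_le 0 (iInf_le_of_le 0 (iInf_le_of_le (fun _ => x)
    (iInf_le_of_le ⟨le_rfl, continuousOn_const, rfl, rfl⟩ ?_)))
  exact (eVariationOn.subsingleton _ (by simp)).le

theorem lengthEDist_comm_le {Z : Type*} [EMetricSpace Z] (x y : Z) :
    lengthEDist x y ≤ lengthEDist y x := by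
  refine le_iInf fun a => le_iInf fun b => le_iInf fun γ => le_iInf fun h => ?_
  obtain ⟨hab, hγ, ha, hb⟩ := h
  have hm : MapsTo (fun t : ℝ => -t) (Icc (-b) (-a)) (Icc a b) := fun t ht =>
    ⟨by linarith [ht.2], by linarith [ht.1]⟩
  refine iInf_le_of_le (-b) (iInf_le_of_le (-a) (iInf_le_of_le (γ ∘ fun t => -t)
    (iInf_le_of_le ⟨by linarith, hγ.comp continuous_neg.continuousOn hm, by simpa using hb,
      by simpa using ha⟩ ?_)))
  exact eVariationOn.comp_le_of_antitoneOn γ _ (fun s _ t _ hst => neg_le_neg hst) hm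

theorem lengthEDist_triangle {Z : Type*} [EMetricSpace Z] (x y z : Z) :
    lengthEDist x z ≤ lengthEDist x y + lengthEDist y z := by
  conv_rhs => simp only [lengthEDist]
  simp only [ENNReal.iInf_add, ENNReal.add_iInf]
  refine le_iInf fun a' => le_iInf fun b' => le_iInf fun γ' => le_iInf fun h' =>
    le_iInf fun a => le_iInf fun b => le_iInf fun γ => le_iInf fun h => ?_
  obtain ⟨hab, hγ, ha, hb⟩ := h
  obtain ⟨hab', hγ', ha', hb'⟩ := h'
  have hbc : b ≤ b + (b' - a') := by linarith
  have hm : MapsTo (fun t : ℝ => t - b + a') (Icc b (b + (b' - a'))) (Icc a' b') := fun t ht =>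
    ⟨by linarith [ht.1], by linarith [ht.2]⟩
  set η : ℝ → Z := fun t => if t ≤ b then γ t else γ' (t - b + a') with hη
  have e1 : EqOn η γ (Icc a b) := fun t ht => by simp [hη, ht.2]
  have e2 : EqOn η (γ' ∘ fun t => t - b + a') (Icc b (b + (b' - a'))) := fun t ht => by
    rcases eq_or_lt_of_le ht.1 with rfl | hlt
    · simp [hη, hb, ha']
    · simp [hη, not_le.2 hlt]
  have c1 : ContinuousOn η (Icc a b) := hγ.congr e1
  have c2 : ContinuousOn η (Icc b (b + (b' - a'))) :=
    (hγ'.comp (by fun_prop) hm).congr e2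
  have c : ContinuousOn η (Icc a (b + (b' - a'))) := by
    rw [← Icc_union_Icc_eq_Icc hab hbc]
    exact c1.union_of_isClosed c2 isClosed_Icc isClosed_Icc
  refine iInf_le_of_le a (iInf_le_of_le (b + (b' - a')) (iInf_le_of_le η
    (iInf_le_of_le ⟨hab.trans hbc, c, ?_, ?_⟩ ?_)))
  · rw [e1 ⟨le_rfl, hab⟩, ha]
  · rw [e2 ⟨hbc, le_rfl⟩, ← hb']
    simp
  · have := eVariationOn.Icc_add_Icc η (s := univ) hab hbc (mem_univ b)
    simp only [univ_inter] at this
    rw [← this, eVariationOn.congr e1, eVariationOn.congr e2]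
    gcongr
    exact eVariationOn.comp_le_of_monotoneOn γ' _ (fun s _ t _ hst => by simpa using hst) hm

theorem edist_le_lengthEDist {Z : Type*} [EMetricSpace Z] (x y : Z) :
    edist x y ≤ lengthEDist x y := by
  refine le_iInf fun a => le_iInf fun b => le_iInf fun γ => le_iInf fun h => ?_
  obtain ⟨hab, -, rfl, rfl⟩ := h
  exact eVariationOn.edist_le γ ⟨le_rfl, hab⟩ ⟨hab, le_rfl⟩

/-- The set `Z` with the length metric induced by the metric of `Z`. -/
structure WithLengthMetric (Z : Type*) where
  /-- The same point with its original metric. -/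
  val : Z

noncomputable instance {Z : Type*} [EMetricSpace Z] : EMetricSpace (WithLengthMetric Z) where
  edist x y := lengthEDist x.val y.val
  edist_self x := lengthEDist_self x.val
  edist_comm x y := le_antisymm (lengthEDist_comm_le _ _) (lengthEDist_comm_le _ _)
  edist_triangle x y z := lengthEDist_triangle x.val y.val z.val
  eq_of_edist_eq_zero {x y} h := by
    have h0 : edist x.val y.val = 0 := le_antisymm ((edist_le_lengthEDist _ _).trans h.le) bot_le
    cases x
    cases y
    exact congrArg _ (edist_eq_zero.1 h0)

namespace CuspSpace

/-! ### The surface `Y` -/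

/-- The Euclidean plane. -/
abbrev Plane : Type := EuclideanSpace ℝ (Fin 2)

/-- The function bounding the cusp. -/
noncomputable def f (t : ℝ) : ℝ := t ^ 3 / 3

/-- The cuspidal region `{(t, y) : 0 ≤ t < 1, 0 ≤ y ≤ f t}`. -/
def Y₀ : Set Plane := {p | 0 ≤ p 0 ∧ p 0 < 1 ∧ 0 ≤ p 1 ∧ p 1 ≤ f (p 0)}

/-- Index set of the slits, which are attached at the dyadic rationals `i / 2 ^ m` of `(0, 1)`, in
lowest terms. -/
structure Slit where
  m : ℕ
  i : ℕ
  one_le_m : 1 ≤ m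
  i_lt : i < 2 ^ m
  odd_i : Odd i

namespace Slit

/-- The dyadic rational `i / 2 ^ m`. -/
noncomputable def t (k : Slit) : ℝ := (k.i : ℝ) / 2 ^ k.m

/-- The side length `2 ^ (-m)` of the pillowcase attached at `k`. -/
noncomputable def side (k : Slit) : ℝ := ((2 : ℝ) ^ k.m)⁻¹

/-- The common length of the slit `I` in `Y₀` and of the slit `J` in the pillowcase. -/
noncomputable def len (k : Slit) : ℝ := min k.side (f k.t)

/-- The slit `I = {t} × [0, len]` without its two endpoints. -/
def openSlit (k : Slit) : Set Plane := {p | p 0 = k.t ∧ 0 < p 1 ∧ p 1 < k.len}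

/-- The square `[0, side]²`, whose double is the pillowcase attached at `k`. -/
def square (k : Slit) : Set Plane := {p | p 0 ∈ Icc 0 k.side ∧ p 1 ∈ Icc 0 k.side}

/-- The part of the boundary of the square along which its two copies are glued to each other: the
whole boundary without the interior of the slit `J = [0, len] × {0}`. -/
def rim (k : Slit) : Set Plane :=
  {p | p ∈ k.square ∧ (p 0 = 0 ∨ p 0 = k.side ∨ p 1 = k.side ∨ (p 1 = 0 ∧ k.len ≤ p 0))}

end Slit

/-- The two sides of a vertical slit. -/
inductive Side : Type
  | left
  | right

/-- The pieces from which `Y` is glued, as a disjoint union.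

* `top σ p`, `p ∈ Y₀`: the top copy of `Y₀` cut along the slits.  If `p` is an interior point of a
  slit, `top left p` and `top right p` are the two points that replace it.  For all other `p`, the
  points `top left p` and `top right p` are going to be identified.
* `bottom p`, `p ∈ Y₀`: the second copy of `Y₀` in the double of `Y₀`.
* `face k σ q`: the two squares that make up the pillowcase attached at the slit `k`. -/
inductive Piece : Type
  | top (σ : Side) (p : Plane) (hp : p ∈ Y₀)
  | bottom (p : Plane) (hp : p ∈ Y₀)
  | face (k : Slit) (σ : Side) (q : Plane) (hq : q ∈ k.square)

/-- A point with first coordinate `t`, approached from the side `σ`, lies to the left of the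
vertical line at `s`. -/
def LiesLeft (s : ℝ) (σ : Side) (t : ℝ) : Prop := t < s ∨ (t = s ∧ σ = Side.left)

/-- The slit at `k` does not obstruct the straight segment from `top σ p` to `top τ q`: the two
endpoints lie on the same side of the vertical line at `k`, or the segment avoids the interior of
the slit. -/
def NotBlocked (k : Slit) (σ τ : Side) (p q : Plane) : Prop :=
  (LiesLeft k.t σ (p 0) ↔ LiesLeft k.t τ (q 0)) ∨ Disjoint (segment ℝ p q) k.openSlit

/-- `Step x y c`: one can pass from `x` to `y` at cost `c`, either along a straight segment in one
of the pieces, at the cost of its Euclidean length, or by a gluing, at no cost. -/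
inductive Step : Piece → Piece → ℝ≥0∞ → Prop
  /-- Straight segment in the top copy of `Y₀`, not crossing any slit.  In particular this
  identifies `top left p` and `top right p` if `p` is not an interior point of a slit. -/
  | top (σ τ : Side) (p q : Plane) (hp : p ∈ Y₀) (hq : q ∈ Y₀) (hpq : segment ℝ p q ⊆ Y₀)
      (h : ∀ k : Slit, NotBlocked k σ τ p q) :
      Step (.top σ p hp) (.top τ q hq) (edist p q)
  /-- Straight segment in the bottom copy of `Y₀`. -/
  | bottom (p q : Plane) (hp : p ∈ Y₀) (hq : q ∈ Y₀) (hpq : segment ℝ p q ⊆ Y₀) :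
      Step (.bottom p hp) (.bottom q hq) (edist p q)
  /-- Straight segment in a face of a pillowcase. -/
  | face (k : Slit) (σ : Side) (p q : Plane) (hp : p ∈ k.square) (hq : q ∈ k.square) :
      Step (.face k σ p hp) (.face k σ q hq) (edist p q)
  /-- The two copies of `Y₀` are glued along the boundary of `Y₀`. -/
  | double (σ : Side) (p : Plane) (hp : p ∈ Y₀) (h : p 1 = 0 ∨ p 1 = f (p 0)) :
      Step (.top σ p hp) (.bottom p hp) 0
  /-- The two faces of a pillowcase are glued along the boundary of the square, except for the
  slit. -/
  | rim (k : Slit) (p : Plane) (hp : p ∈ k.square) (h : p ∈ k.rim) :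
      Step (.face k .left p hp) (.face k .right p hp) 0
  /-- Each side of the slit `I` is glued to the slit `J` in one of the two faces of the
  pillowcase. -/
  | slit (k : Slit) (σ : Side) (p q : Plane) (hp : p ∈ Y₀) (hq : q ∈ k.square)
      (hI : p 0 = k.t ∧ p 1 ≤ k.len) (hJ : q 0 = p 1 ∧ q 1 = 0) :
      Step (.top σ p hp) (.face k σ q hq) 0
  | symm (x y : Piece) (c : ℝ≥0∞) (h : Step x y c) : Step y x c

/-- The cost of the cheapest single step from `x` to `y`, and `∞` if there is none. -/
noncomputable def stepCost (x y : Piece) : ℝ≥0∞ := ⨅ (c : ℝ≥0∞) (_ : Step x y c), c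

theorem stepCost_comm (x y : Piece) : stepCost x y = stepCost y x :=
  le_antisymm
    (le_iInf fun c => le_iInf fun h => iInf_le_of_le c (iInf_le_of_le (.symm _ _ _ h) le_rfl))
    (le_iInf fun c => le_iInf fun h => iInf_le_of_le c (iInf_le_of_le (.symm _ _ _ h) le_rfl))

/-- The length pseudometric of the gluing: the infimum of the lengths of polygonal paths, which may
pass between pieces along the glued edges. -/
noncomputable instance : PseudoEMetricSpace Piece := chainPseudoEMetric stepCost stepCost_comm

/-- The surface `Y`, with its length metric. -/
abbrev Y : Type := SeparationQuotient Piece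

theorem zero_mem_Y₀ : (0 : Plane) ∈ Y₀ := by simp [Y₀, f]

/-- The cusp point `z = (0, 0)` of `Y`. -/
noncomputable def cusp : Y := SeparationQuotient.mk (Piece.top .left 0 zero_mem_Y₀)

/-! ### The space `X`, the continuum `E` and the collapsed space -/

/-- The space `X = Y × (-2, 2)` with the Euclidean product metric. -/
abbrev X : Type := WithLp 2 (Y × Ioo (-2 : ℝ) 2)

/-- The continuum `E = {z} × [-1, 1]`. -/
def E : Set X := {x | x.fst = cusp ∧ (x.snd : ℝ) ∈ Icc (-1 : ℝ) 1}

/-- The space obtained from `X` by collapsing `E` to a point, with the induced length metric. -/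
abbrev XTilde : Type := WithLengthMetric (CollapseQuotient X E)

/-- The quotient map from `X` to the collapsed space. -/
noncomputable def collapse (x : X) : XTilde :=
  ⟨SeparationQuotient.mk (show CollapsePre X E from x)⟩

noncomputable instance : MeasurableSpace X := borel X

instance : BorelSpace X := ⟨rfl⟩

noncomputable instance : MeasurableSpace XTilde := borel XTilde

instance : BorelSpace XTilde := ⟨rfl⟩

end CuspSpace

/-!
The quotient map `collapse` is injective off the continuum `E`, which it maps to a single point.
The moduli agree for three reasons.

*Off `E` the map is a local isometry.*  The quotient metric is the minimum of the distance in `X`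
and the distance through `E` (`CollapseQuotient.le_edist_mk`), and passing to the length metric
changes nothing, since `Y`, `X` and `X / E` are length spaces: each step of a chain is realized by
a curve of the right length (`lipJoined_of_chainEDist_lt`, `IsLengthSpace.withLp_prod`).  So curves
that avoid `E` have the same line integrals as their images
(`IsLocalIsometryOn.lineIntegral_map`), and `collapse` preserves Hausdorff `3`-measure
(`CuspSpace.measurePreserving_collapse`), because `E` and its image are null sets.

*Nonconstant curves that meet `E` are negligible, in `X` and in the quotient.*  Extend the
coordinate `t` of the cuspidal region to `Y` by giving it a constant value on each pillowcase.  This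
is a `1`-Lipschitz function on `X` that vanishes only over the cusp and descends to the quotient.
Let `g` be `1 / t`, replaced by `0` where `t` is the coordinate of a slit, hence on all pillowcases.
The exceptional values of `t` are countably many, and a `1`-Lipschitz function of arc length does
not increase Lebesgue measure; so the integral of `g` over a curve on which `t` reaches `0` is at
least `∫ dt / t = ∞`, unless `t` vanishes identically on the curve, where `g = ∞`
(`Curve.lineIntegral_invOff_eq_top`).

*The function `g` has finite energy.*  The set `g ≠ 0` lies over the two copies of `Y₀`.  The
columns over dyadic intervals of length `2 ^ (-M)` are met only by slits shorter than `2 ^ (-M)`,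
and these can be avoided by moving along `y = 0`; therefore `Y₀` can be covered as efficiently as if
it were not cut (`CuspSpace.edist_le_of_mem_cell`).  As the cusp has height `t ^ 3 / 3`, the part
over `t ≤ r` has volume of order `r ^ 4` (`CuspSpace.hausdorffMeasure_cuspPart_le`), which makes
`∫ t ^ (-3)` finite (`CuspSpace.lintegral_invOff_tCoord_lt_top`).

Given a density that is admissible for one family, its transplant to the other space becomes
admissible after taking the maximum with an arbitrarily small multiple of `g`, which does not affect
the infimum of the energies (`modulus_le_of_isAdmissible_max`).
-/

/-! ### Arc length and line integrals -/

section CurvesAndLineIntegrals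
open Filter Topology

theorem continuousOn_variationOnFromTo {Z : Type*} [EMetricSpace Z] {f : ℝ → Z} {s : Set ℝ}
    (hf : ContinuousOn f s) (hv : BoundedVariationOn f s) {a : ℝ} (ha : a ∈ s) :
    ContinuousOn (variationOnFromTo f s a) s := by
  intro x hx
  have h1 := hv.tendsto_eVariationOn_Icc_zero_left ((hf x hx).mono inter_subset_left)
  have h2 := hv.tendsto_eVariationOn_Icc_zero_right x ((hf x hx).mono inter_subset_left)
  have h3 := (((ENNReal.tendsto_toReal ENNReal.zero_ne_top).comp h2).sub
    ((ENNReal.tendsto_toReal ENNReal.zero_ne_top).comp h1)).const_add (variationOnFromTo f s a x)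
  simp only [ENNReal.toReal_zero, sub_zero, add_zero] at h3
  refine Tendsto.congr' ?_ h3
  filter_upwards [self_mem_nhdsWithin] with y hy
  rw [← variationOnFromTo.add hv.locallyBoundedVariationOn ha hx hy]
  have hz : ∀ p q : ℝ, p ≤ q → eVariationOn f (s ∩ Icc q p) = 0 := fun p q hpq =>
    eVariationOn.subsingleton _ fun z hz w hw => by
      have h1 := hz.2.1; have h2 := hz.2.2; have h3 := hw.2.1; have h4 := hw.2.2
      linarith
  congr 1
  rcases le_total x y with h | h
  · simp [variationOnFromTo.eq_of_le f s h, hz x y h]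
  · simp [variationOnFromTo.eq_of_ge f s h, hz y x h]

section NaturalParameterization

variable {Z : Type*} [EMetricSpace Z] {f : ℝ → Z} {a b : ℝ}

theorem variationOnFromTo_Icc_self (hab : a ≤ b) :
    variationOnFromTo f (Icc a b) a b = (eVariationOn f (Icc a b)).toReal := by
  rw [variationOnFromTo.eq_of_le _ _ hab, inter_self]

/-- The arc length function of a continuous curve takes all intermediate values, so that the
arc length parametrization has no gaps. -/
theorem image_variationOnFromTo_Icc (hab : a ≤ b) (hf : ContinuousOn f (Icc a b))
    (hv : BoundedVariationOn f (Icc a b)) :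
    variationOnFromTo f (Icc a b) a '' Icc a b = Icc 0 (eVariationOn f (Icc a b)).toReal := by
  have ha : a ∈ Icc a b := ⟨le_rfl, hab⟩
  have hb : b ∈ Icc a b := ⟨hab, le_rfl⟩
  rw [← variationOnFromTo_Icc_self hab, ← variationOnFromTo.self f (Icc a b) a]
  refine Subset.antisymm ?_ (intermediate_value_Icc hab (continuousOn_variationOnFromTo hf hv ha))
  rintro _ ⟨x, hx, rfl⟩
  have hm := variationOnFromTo.monotoneOn hv.locallyBoundedVariationOn ha
  exact ⟨hm ha hx hx.1, hm hx hb hx.2⟩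

theorem lipschitzOnWith_naturalParameterization (hab : a ≤ b) (hf : ContinuousOn f (Icc a b))
    (hv : BoundedVariationOn f (Icc a b)) :
    LipschitzOnWith 1 (naturalParameterization f (Icc a b) a)
      (Icc 0 (eVariationOn f (Icc a b)).toReal) := by
  have ha : a ∈ Icc a b := ⟨le_rfl, hab⟩
  have hs := has_unit_speed_naturalParameterization f hv.locallyBoundedVariationOn ha
  rw [image_variationOnFromTo_Icc hab hf hv] at hs
  have key : ∀ x ∈ Icc 0 (eVariationOn f (Icc a b)).toReal,
      ∀ y ∈ Icc 0 (eVariationOn f (Icc a b)).toReal, x ≤ y →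
      edist (naturalParameterization f (Icc a b) a x) (naturalParameterization f (Icc a b) a y)
        ≤ edist x y := by
    intro x hx y hy hxy
    refine (eVariationOn.edist_le (s := Icc 0 _ ∩ Icc x y) _ ⟨hx, le_rfl, hxy⟩
      ⟨hy, hxy, le_rfl⟩).trans ?_
    rw [hs hx hy, edist_dist, Real.dist_eq, abs_sub_comm, abs_of_nonneg (sub_nonneg.2 hxy)]
    simp
  intro x hx y hy
  rw [ENNReal.coe_one, one_mul]
  rcases le_total x y with h | h
  · exact key x hx y hy h
  · rw [edist_comm, edist_comm x]
    exact key y hy x hx h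

theorem naturalParameterization_mem_image (hab : a ≤ b) (hf : ContinuousOn f (Icc a b))
    (hv : BoundedVariationOn f (Icc a b)) {s : ℝ}
    (hs : s ∈ Icc 0 (eVariationOn f (Icc a b)).toReal) :
    naturalParameterization f (Icc a b) a s ∈ f '' Icc a b := by
  rw [← image_variationOnFromTo_Icc hab hf hv] at hs
  have : Nonempty ℝ := ⟨a⟩
  exact mem_image_of_mem _ (Function.invFunOn_mem hs)

theorem naturalParameterization_left (hab : a ≤ b) (hv : BoundedVariationOn f (Icc a b)) :
    naturalParameterization f (Icc a b) a 0 = f a := by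
  have ha : a ∈ Icc a b := ⟨le_rfl, hab⟩
  have h := edist_naturalParameterization_eq_zero hv.locallyBoundedVariationOn ha ha
  rw [variationOnFromTo.self] at h
  exact edist_eq_zero.1 h

theorem naturalParameterization_right (hab : a ≤ b) (hv : BoundedVariationOn f (Icc a b)) :
    naturalParameterization f (Icc a b) a (eVariationOn f (Icc a b)).toReal = f b := by
  have ha : a ∈ Icc a b := ⟨le_rfl, hab⟩
  have hb : b ∈ Icc a b := ⟨hab, le_rfl⟩
  have h := edist_naturalParameterization_eq_zero hv.locallyBoundedVariationOn ha hb
  rw [variationOnFromTo_Icc_self hab] at h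
  exact edist_eq_zero.1 h

end NaturalParameterization

/-- The function `r ↦ 1 / r`, with value `∞` for `r ≤ 0`, replaced by `0` on the set `C`. -/
noncomputable def invOff (C : Set ℝ) (r : ℝ) : ℝ≥0∞ :=
  Cᶜ.indicator (fun r => (ENNReal.ofReal r)⁻¹) r

theorem measurable_invOff {C : Set ℝ} (hC : C.Countable) : Measurable (invOff C) :=
  (ENNReal.measurable_ofReal.inv).indicator hC.measurableSet.compl

theorem lintegral_Icc_inv_eq_top {r : ℝ} (hr : 0 < r) :
    ∫⁻ x in Icc 0 r, (ENNReal.ofReal x)⁻¹ = ∞ := by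
  by_contra h
  rw [setLIntegral_congr Ioc_ae_eq_Icc.symm] at h
  have h1 : IntervalIntegrable (fun x : ℝ => x⁻¹) volume 0 r := by
    rw [intervalIntegrable_iff_integrableOn_Ioc_of_le hr.le]
    refine ⟨measurable_inv.aestronglyMeasurable, ?_⟩
    rw [HasFiniteIntegral]
    refine lt_of_le_of_lt (le_of_eq (setLIntegral_congr_fun measurableSet_Ioc fun x hx => ?_))
      (lt_top_iff_ne_top.2 h)
    rw [Real.enorm_of_nonneg (inv_nonneg.2 hx.1.le), ENNReal.ofReal_inv_of_pos hx.1]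
  rw [intervalIntegrable_inv_iff] at h1
  rcases h1 with h1 | h1
  · exact hr.ne h1
  · exact h1 left_mem_uIcc

/-- The change of variables `r = v s` in the form needed here: a `1`-Lipschitz function does not
increase length, so the image under `v` of Lebesgue measure dominates Lebesgue measure on the range
of `v`.  The integral of `1 / r` over that range diverges. -/
theorem lintegral_invOff_comp_eq_top {C : Set ℝ} (hC : C.Countable) {v : ℝ → ℝ} {l : ℝ}
    (hv : LipschitzOnWith 1 v (Icc 0 l)) {s₁ s₂ : ℝ} (h₁ : s₁ ∈ Icc 0 l) (h₂ : s₂ ∈ Icc 0 l)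
    (hv₁ : v s₁ = 0) (hv₂ : 0 < v s₂) : ∫⁻ s in Icc 0 l, invOff C (v s) = ∞ := by
  obtain ⟨w, hw, hwv⟩ := hv.extend_real
  have hle : volume.restrict (Icc 0 (v s₂)) ≤ (volume.restrict (Icc 0 l)).map w := by
    refine Measure.le_iff.2 fun B hB => ?_
    rw [Measure.restrict_apply hB, Measure.map_apply hw.continuous.measurable hB,
      Measure.restrict_apply (hw.continuous.measurable hB)]
    have hsub : B ∩ Icc 0 (v s₂) ⊆ w '' (w ⁻¹' B ∩ Icc 0 l) := by
      rintro y ⟨hy, hy'⟩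
      have hy2 : y ∈ uIcc (w s₁) (w s₂) := by
        rw [← hwv h₁, ← hwv h₂, hv₁, uIcc_of_le hv₂.le]
        exact hy'
      obtain ⟨s, hs, rfl⟩ := intermediate_value_uIcc (hw.continuous.continuousOn) hy2
      exact ⟨s, ⟨hy, uIcc_subset_Icc h₁ h₂ hs⟩, rfl⟩
    have h := hw.hausdorffMeasure_image_le (d := 1) zero_le_one (w ⁻¹' B ∩ Icc 0 l)
    rw [hausdorffMeasure_real] at h
    exact (measure_mono hsub).trans (by simpa using h)
  rw [setLIntegral_congr_fun measurableSet_Icc (g := fun s => invOff C (w s))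
    (fun s hs => by simp only [hwv hs]), ← lintegral_map (measurable_invOff hC)
    hw.continuous.measurable, eq_top_iff]
  refine le_trans ?_ (lintegral_mono' hle le_rfl)
  rw [← lintegral_Icc_inv_eq_top hv₂]
  refine le_of_eq (lintegral_congr_ae (ae_restrict_of_ae ?_))
  filter_upwards [hC.ae_notMem volume] with x hx
  simp [invOff, hx]

namespace Curve

variable {Z : Type*} [EMetricSpace Z]

theorem le_lineIntegral (γ : Curve Z) (ρ : Z → ℝ≥0∞) {a b : ℝ} (ha : a ∈ γ.dom) (hb : b ∈ γ.dom)
    (hab : a ≤ b) : ∫⁻ s in Icc (0 : ℝ) (eVariationOn γ.toFun (Icc a b)).toReal,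
      ρ (naturalParameterization γ.toFun (Icc a b) a s) ≤ γ.lineIntegral ρ :=
  le_iSup_of_le a (le_iSup_of_le b (le_iSup_of_le ha (le_iSup_of_le hb (le_iSup_of_le hab le_rfl))))

theorem lineIntegral_mono (γ : Curve Z) {ρ σ : Z → ℝ≥0∞} (h : ρ ≤ σ) :
    γ.lineIntegral ρ ≤ γ.lineIntegral σ := by
  unfold lineIntegral
  gcongr
  exact h _

theorem lineIntegral_const_mul_eq_top (γ : Curve Z) {ρ : Z → ℝ≥0∞} (hρ : γ.lineIntegral ρ = ∞)
    {c : ℝ≥0∞} (hc : c ≠ 0) (hc' : c ≠ ∞) : γ.lineIntegral (fun z => c * ρ z) = ∞ := by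
  unfold lineIntegral at hρ ⊢
  simp only [lintegral_const_mul' _ _ hc', ← ENNReal.mul_iSup]
  rw [hρ, ENNReal.mul_top hc]

theorem lineIntegral_eq_zero_of_isTrivial {γ : Curve Z} (h : γ.IsTrivial) (ρ : Z → ℝ≥0∞) :
    γ.lineIntegral ρ = 0 := by
  unfold lineIntegral
  simp only [ENNReal.iSup_eq_zero]
  intro a b ha hb hab
  rw [eVariationOn.constant_on (h.anti (image_mono (γ.dom_ordConnected.out ha hb)))]
  simp

theorem isLocallyRectifiable_of_isTrivial {γ : Curve Z} (h : γ.IsTrivial) :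
    γ.IsLocallyRectifiable := fun a b _ _ => by
  rw [BoundedVariationOn, eVariationOn.constant_on (h.anti (image_mono inter_subset_left))]
  simp

theorem IsLocallyRectifiable.boundedVariationOn {γ : Curve Z} (h : γ.IsLocallyRectifiable)
    {a b : ℝ} (ha : a ∈ γ.dom) (hb : b ∈ γ.dom) : BoundedVariationOn γ.toFun (Icc a b) := by
  have := h a b ha hb
  rwa [inter_eq_self_of_subset_right (γ.dom_ordConnected.out ha hb)] at this

/-- The arc length parametrization has no gaps, so it takes its values in the trace, and only the
values of the density there matter. -/
theorem lineIntegral_congr {γ : Curve Z} (hγ : γ.IsLocallyRectifiable) {ρ σ : Z → ℝ≥0∞}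
    (h : EqOn ρ σ γ.trace) : γ.lineIntegral ρ = γ.lineIntegral σ := by
  unfold lineIntegral
  refine iSup_congr fun a => iSup_congr fun b => iSup_congr fun ha => iSup_congr fun hb =>
    iSup_congr fun hab => setLIntegral_congr_fun measurableSet_Icc fun s hs => ?_
  have hsub : Icc a b ⊆ γ.dom := γ.dom_ordConnected.out ha hb
  exact h (image_mono hsub (naturalParameterization_mem_image hab (γ.continuousOn.mono hsub)
    (hγ.boundedVariationOn ha hb) hs))

/-- A nonconstant curve that meets the zero set of a `1`-Lipschitz function `u` either stays in
this set, where the integrand is infinite, or leaves it, and then `∫ ds / u` diverges.  Deleting a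
countable set of levels of `u` changes nothing, since arc length on these levels is not needed to
change the value of `u`. -/
theorem lineIntegral_invOff_eq_top {C : Set ℝ} (hC : C.Countable) (hC0 : (0 : ℝ) ∉ C) {u : Z → ℝ}
    (hu : LipschitzWith 1 u) (hu0 : ∀ z, 0 ≤ u z) {γ : Curve Z} (hγ : γ.IsLocallyRectifiable)
    (hmeet : ∃ z ∈ γ.trace, u z = 0) (hnt : ¬ γ.IsTrivial) :
    γ.lineIntegral (fun z => invOff C (u z)) = ∞ := by
  obtain ⟨_, ⟨a, ha, rfl⟩, hua⟩ := hmeet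
  by_cases h : ∀ x ∈ γ.dom, u (γ.toFun x) = 0
  · -- the curve stays in the zero set of `u`
    obtain ⟨x, hx, y, hy, hxy, hne⟩ : ∃ x ∈ γ.dom, ∃ y ∈ γ.dom, x ≤ y ∧
        γ.toFun x ≠ γ.toFun y := by
      by_contra! hcon
      refine hnt ?_
      rintro _ ⟨x, hx, rfl⟩ _ ⟨y, hy, rfl⟩
      rcases le_total x y with hxy | hxy
      · exact hcon x hx y hy hxy
      · exact (hcon y hy x hx hxy).symm
    have hv := hγ.boundedVariationOn hx hy
    have hsub := γ.dom_ordConnected.out hx hy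
    have hpos : 0 < eVariationOn γ.toFun (Icc x y) :=
      (edist_pos.2 hne).trans_le (eVariationOn.edist_le _ ⟨le_rfl, hxy⟩ ⟨hxy, le_rfl⟩)
    rw [eq_top_iff]
    refine le_trans (le_of_eq ?_) (γ.le_lineIntegral _ hx hy hxy)
    rw [setLIntegral_congr_fun measurableSet_Icc (g := fun _ => ∞), setLIntegral_const,
      Real.volume_Icc, sub_zero, ENNReal.ofReal_toReal hv, ENNReal.top_mul hpos.ne']
    intro s hs
    obtain ⟨z, hz, hzs⟩ := naturalParameterization_mem_image hxy (γ.continuousOn.mono hsub) hv hs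
    simp only
    rw [← hzs, h z (hsub hz)]
    simp [invOff, hC0]
  · push Not at h
    obtain ⟨b, hb, hub⟩ := h
    have hub' : 0 < u (γ.toFun b) := lt_of_le_of_ne (hu0 _) (Ne.symm hub)
    have key : ∀ x ∈ γ.dom, ∀ y ∈ γ.dom, x ≤ y →
        ((u (γ.toFun x) = 0 ∧ 0 < u (γ.toFun y)) ∨ (u (γ.toFun y) = 0 ∧ 0 < u (γ.toFun x))) →
        γ.lineIntegral (fun z => invOff C (u z)) = ∞ := by
      intro x hx y hy hxy hor
      have hv := hγ.boundedVariationOn hx hy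
      have hc := γ.continuousOn.mono (γ.dom_ordConnected.out hx hy)
      have hl := hu.comp_lipschitzOnWith (lipschitzOnWith_naturalParameterization hxy hc hv)
      rw [mul_one] at hl
      have e0 : (0 : ℝ) ∈ Icc 0 (eVariationOn γ.toFun (Icc x y)).toReal :=
        ⟨le_rfl, ENNReal.toReal_nonneg⟩
      have e1 : (eVariationOn γ.toFun (Icc x y)).toReal ∈
        Icc 0 (eVariationOn γ.toFun (Icc x y)).toReal := ⟨ENNReal.toReal_nonneg, le_rfl⟩
      rw [eq_top_iff]
      refine le_trans (le_of_eq (Eq.symm ?_)) (γ.le_lineIntegral _ hx hy hxy)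
      rcases hor with ⟨h1, h2⟩ | ⟨h1, h2⟩
      · refine lintegral_invOff_comp_eq_top hC hl e0 e1 ?_ ?_
        · rw [naturalParameterization_left hxy hv, h1]
        · rw [naturalParameterization_right hxy hv]
          exact h2
      · refine lintegral_invOff_comp_eq_top hC hl e1 e0 ?_ ?_
        · rw [naturalParameterization_right hxy hv, h1]
        · rw [naturalParameterization_left hxy hv]
          exact h2
    rcases le_total a b with hab | hab
    · exact key a ha b hb hab (Or.inl ⟨hua, hub'⟩)
    · exact key b hb a ha hab (Or.inr ⟨hua, hub'⟩)

end Curve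

/-! ### Maps that preserve small distances -/

/-- `h` preserves distances in a neighbourhood of each point of `U`. -/
def IsLocalIsometryOn {Z W : Type*} [EMetricSpace Z] [EMetricSpace W] (h : Z → W)
    (U : Set Z) : Prop :=
  ∀ z ∈ U, ∃ V ∈ 𝓝 z, ∀ p ∈ V, ∀ q ∈ V, edist (h p) (h q) = edist p q

section LocalIsometry

variable {Z W : Type*} [EMetricSpace Z] [EMetricSpace W] {h : Z → W} {U : Set Z}

theorem eVariationOn_comp_of_edist_eq {f : ℝ → Z} {s : Set ℝ}
    (hs : ∀ x ∈ s, ∀ y ∈ s, edist (h (f x)) (h (f y)) = edist (f x) (f y)) :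
    eVariationOn (h ∘ f) s = eVariationOn f s := by
  unfold eVariationOn
  refine iSup_congr fun p => Finset.sum_congr rfl fun i _ => ?_
  exact hs _ (p.2.2.2 _) _ (p.2.2.2 _)

theorem IsLocalIsometryOn.eVariationOn_comp (hh : IsLocalIsometryOn h U) {f : ℝ → Z} {a b : ℝ}
    (hf : ContinuousOn f (Icc a b)) (hfU : MapsTo f (Icc a b) U) :
    eVariationOn (h ∘ f) (Icc a b) = eVariationOn f (Icc a b) := by
  rcases lt_or_ge b a with hab | hab
  · simp [Icc_eq_empty_of_lt hab]
  choose! V hV hVd using hh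
  have hfr : Continuous ((Icc a b).domRestrict f) := continuousOn_iff_continuous_domRestrict.1 hf
  -- subdivide `[a, b]` into intervals on each of which `h` preserves the distances of values of `f`
  obtain ⟨t, ht0, htm, ⟨m, hm⟩, htc⟩ := exists_monotone_Icc_subset_open_cover_Icc hab
    (c := fun x : Icc a b => (Icc a b).domRestrict f ⁻¹' interior (V (f x)))
    (fun x => isOpen_interior.preimage hfr)
    (fun x _ => mem_iUnion.2 ⟨x, mem_interior_iff_mem_nhds.2 (hV _ (hfU x.2))⟩)
  have htm' : Monotone fun n => (t n : ℝ) := fun i j hij => htm hij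
  have h1 := eVariationOn.sum' (h ∘ f) htm' (n := m)
  have h2 := eVariationOn.sum' f htm' (n := m)
  simp only [ht0, hm m le_rfl] at h1 h2
  rw [← h1, ← h2]
  refine Finset.sum_congr rfl fun i _ => eVariationOn_comp_of_edist_eq fun x hx y hy => ?_
  obtain ⟨z, hz⟩ := htc i
  have hmem : ∀ x ∈ Icc (t i : ℝ) (t (i + 1)), f x ∈ V (f z) := fun x hx =>
    interior_subset (hz (show (⟨x, (t i).2.1.trans hx.1, hx.2.trans (t (i + 1)).2.2⟩ : Icc a b) ∈
      Icc (t i) (t (i + 1)) from hx))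
  exact hVd _ (hfU z.2) _ (hmem x hx) _ (hmem y hy)

theorem IsLocalIsometryOn.variationOnFromTo_comp (hh : IsLocalIsometryOn h U) {f : ℝ → Z} {a b : ℝ}
    (hf : ContinuousOn f (Icc a b)) (hfU : MapsTo f (Icc a b) U) (x y : ℝ) :
    variationOnFromTo (h ∘ f) (Icc a b) x y = variationOnFromTo f (Icc a b) x y := by
  have key : ∀ x y, eVariationOn (h ∘ f) (Icc a b ∩ Icc x y) = eVariationOn f (Icc a b ∩ Icc x y) :=
    fun x y => by
      have hsub : Icc a b ∩ Icc x y ⊆ Icc a b := inter_subset_left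
      rw [Icc_inter_Icc] at hsub ⊢
      exact hh.eVariationOn_comp (hf.mono hsub) (hfU.mono_left hsub)
  simp only [variationOnFromTo, key]

variable {γ : Curve Z} {hc : Continuous h}

theorem IsLocalIsometryOn.isLocallyRectifiable_map (hh : IsLocalIsometryOn h U)
    (hγ : γ.trace ⊆ U) : (γ.map h hc).IsLocallyRectifiable ↔ γ.IsLocallyRectifiable := by
  refine forall_congr' fun a => forall_congr' fun b => forall_congr' fun ha =>
    forall_congr' fun hb => ?_
  have hsub := γ.dom_ordConnected.out ha hb
  change eVariationOn (h ∘ γ.toFun) (γ.dom ∩ _) ≠ ⊤ ↔ eVariationOn γ.toFun (γ.dom ∩ _) ≠ ⊤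
  rw [inter_eq_self_of_subset_right hsub, hh.eVariationOn_comp (γ.continuousOn.mono hsub)
    (fun x hx => hγ ⟨x, hsub hx, rfl⟩)]

theorem IsLocalIsometryOn.lineIntegral_map (hh : IsLocalIsometryOn h U) (hγ : γ.trace ⊆ U)
    (ρ : W → ℝ≥0∞) : (γ.map h hc).lineIntegral ρ = γ.lineIntegral (ρ ∘ h) := by
  unfold Curve.lineIntegral
  refine iSup_congr fun a => iSup_congr fun b => iSup_congr fun ha => iSup_congr fun hb =>
    iSup_congr fun hab => ?_
  have hsub : Icc a b ⊆ γ.dom := γ.dom_ordConnected.out ha hb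
  have hc' := γ.continuousOn.mono hsub
  have hU : MapsTo γ.toFun (Icc a b) U := fun x hx => hγ ⟨x, hsub hx, rfl⟩
  change ∫⁻ s in Icc (0 : ℝ) (eVariationOn (h ∘ γ.toFun) (Icc a b)).toReal,
    ρ (naturalParameterization (h ∘ γ.toFun) (Icc a b) a s) = _
  rw [hh.eVariationOn_comp hc' hU]
  have : naturalParameterization (h ∘ γ.toFun) (Icc a b) a =
      h ∘ naturalParameterization γ.toFun (Icc a b) a := by
    unfold naturalParameterization
    rw [show variationOnFromTo (h ∘ γ.toFun) (Icc a b) a =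
      variationOnFromTo γ.toFun (Icc a b) a from funext (hh.variationOnFromTo_comp hc' hU a)]
    rfl
  rw [this]
  rfl

/-- A map that does not increase distances below some scale `r` does not increase Hausdorff measure,
since the latter can be computed from coverings by sets of diameter at most `r`. -/
theorem hausdorffMeasure_image_le_of_edist_le [MeasurableSpace Z] [BorelSpace Z]
    [MeasurableSpace W] [BorelSpace W] {d : ℝ} (hd : 0 ≤ d) {s : Set Z} {r : ℝ≥0∞} (hr : 0 < r)
    (hs : ∀ x ∈ s, ∀ y ∈ s, edist x y ≤ r → edist (h x) (h y) ≤ edist x y) :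
    Measure.hausdorffMeasure d (h '' s) ≤ Measure.hausdorffMeasure d s := by
  simp only [Measure.hausdorffMeasure_apply]
  refine iSup₂_le fun δ hδ => le_iSup₂_of_le (min δ r) (lt_min hδ hr) ?_
  refine le_iInf fun t => le_iInf fun hst => le_iInf fun ht => ?_
  have hdiam : ∀ n, Metric.ediam (h '' (t n ∩ s)) ≤ Metric.ediam (t n) := by
    intro n
    refine Metric.ediam_le ?_
    rintro _ ⟨x, ⟨hx, hxs⟩, rfl⟩ _ ⟨y, ⟨hy, hys⟩, rfl⟩
    have hxy := Metric.edist_le_ediam_of_mem hx hy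
    exact (hs x hxs y hys (hxy.trans ((ht n).trans (min_le_right _ _)))).trans hxy
  refine iInf_le_of_le (fun n => h '' (t n ∩ s)) (iInf_le_of_le ?_ (iInf_le_of_le
    (fun n => (hdiam n).trans ((ht n).trans (min_le_left _ _))) ?_))
  · rw [← image_iUnion, ← iUnion_inter]
    exact image_mono (subset_inter hst Subset.rfl)
  · refine ENNReal.tsum_le_tsum fun n => iSup_le fun hn => ?_
    refine le_iSup_of_le (hn.of_image.mono inter_subset_left) ?_
    exact ENNReal.rpow_le_rpow (hdiam n) hd

end LocalIsometry

end CurvesAndLineIntegrals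

/-! ### Chain metrics and length metrics -/

section LengthSpaces
open scoped NNReal

theorem chainEDist_le {P : Type*} (c : P → P → ℝ≥0∞) (x y : P) : chainEDist c x y ≤ c x y :=
  iInf_le_of_le 1 (iInf_le_of_le (fun i => if i = 0 then x else y)
    (iInf_le_of_le (by simp) (iInf_le_of_le (by simp) (by simp))))

theorem le_chainEDist {P : Type*} {c d : P → P → ℝ≥0∞} (hself : ∀ x, d x x = 0)
    (htri : ∀ x y z, d x z ≤ d x y + d y z) (hdc : ∀ x y, d x y ≤ c x y) (x y : P) :
    d x y ≤ chainEDist c x y := by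
  refine le_iInf fun n => le_iInf fun u => le_iInf fun h0 => le_iInf fun hn => ?_
  subst h0 hn
  induction n with
  | zero => simp [hself]
  | succ n ih =>
    rw [Finset.sum_range_succ]
    exact (htri _ (u n) _).trans (add_le_add ih (hdc _ _))

/-- A map out of a chain metric is `1`-Lipschitz as soon as it is so along each single step. -/
theorem edist_le_chainEDist {P Z : Type*} [PseudoEMetricSpace Z] {c : P → P → ℝ≥0∞} {φ : P → Z}
    (h : ∀ x y, edist (φ x) (φ y) ≤ c x y) (x y : P) : edist (φ x) (φ y) ≤ chainEDist c x y :=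
  le_chainEDist (d := fun x y => edist (φ x) (φ y)) (fun _ => edist_self _)
    (fun _ _ _ => edist_triangle _ _ _) h x y

/-- The points `x` and `y` are joined by a curve of length at most `L`, parametrized so as to be
`1`-Lipschitz on `[0, L]`, and extended to all of `ℝ`. -/
def LipJoined {Z : Type*} [PseudoEMetricSpace Z] (x y : Z) (L : ℝ≥0) : Prop :=
  ∃ γ : ℝ → Z, LipschitzWith 1 γ ∧ γ 0 = x ∧ γ L = y

/-- A length space: the distance of two points is the infimum of the lengths of the curves that
join them. -/
def IsLengthSpace (Z : Type*) [PseudoEMetricSpace Z] : Prop :=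
  ∀ (x y : Z) (L : ℝ≥0), edist x y < L → LipJoined x y L

namespace LipJoined

variable {Z W : Type*} [PseudoEMetricSpace Z] [PseudoEMetricSpace W] {x y z : Z} {L M : ℝ≥0}

theorem refl (x : Z) (L : ℝ≥0) : LipJoined x x L :=
  ⟨fun _ => x, LipschitzWith.const' x, rfl, rfl⟩

theorem map (h : LipJoined x y L) {φ : Z → W} (hφ : LipschitzWith 1 φ) :
    LipJoined (φ x) (φ y) L := by
  obtain ⟨γ, hγ, rfl, rfl⟩ := h
  exact ⟨φ ∘ γ, by simpa using hφ.comp hγ, rfl, rfl⟩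

theorem symm (h : LipJoined x y L) : LipJoined y x L := by
  obtain ⟨γ, hγ, rfl, rfl⟩ := h
  refine ⟨fun s => γ (L - s), ?_, by simp, by simp⟩
  intro s t
  refine (hγ _ _).trans (le_of_eq ?_)
  rw [edist_sub_left, ENNReal.coe_one, one_mul]

theorem mono (h : LipJoined x y L) (hLM : L ≤ M) : LipJoined x y M := by
  obtain ⟨γ, hγ, rfl, rfl⟩ := h
  refine ⟨fun s => γ (min s L), ?_, by simp, by simp [hLM]⟩
  have := hγ.comp (LipschitzWith.id.min_const (L : ℝ))
  rwa [mul_one] at this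

theorem trans (h₁ : LipJoined x y L) (h₂ : LipJoined y z M) : LipJoined x z (L + M) := by
  obtain ⟨γ, hγ, rfl, rfl⟩ := h₁
  obtain ⟨η, hη, hη0, rfl⟩ := h₂
  refine ⟨fun s => if s ≤ L then γ s else η (s - L), ?_, by simp, ?_⟩
  · have key : ∀ s t : ℝ, s ≤ t → edist (if s ≤ L then γ s else η (s - L))
        (if t ≤ L then γ t else η (t - L)) ≤ edist s t := by
      intro s t hst
      split_ifs with h1 h2 h2
      · simpa using hγ s t
      · refine (edist_triangle _ (γ L) _).trans ?_
        have e1 := hγ s L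
        have e2 := hη 0 (t - L)
        rw [hη0] at e2
        refine (add_le_add e1 e2).trans (le_of_eq ?_)
        push Not at h2
        simp only [ENNReal.coe_one, one_mul, edist_dist, Real.dist_eq]
        rw [← ENNReal.ofReal_add (abs_nonneg _) (abs_nonneg _), abs_of_nonpos (by linarith),
          abs_of_nonpos (by linarith), abs_of_nonpos (by linarith)]
        congr 1
        ring
      · exact absurd (hst.trans h2) h1
      · refine (hη _ _).trans (le_of_eq ?_)
        simp [edist_dist, Real.dist_eq]
    intro s t
    rw [ENNReal.coe_one, one_mul]
    rcases le_total s t with h | h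
    · exact key s t h
    · rw [edist_comm, edist_comm s]
      exact key t s h
  · by_cases hM : M = 0
    · simp [hM, hη0]
    · have : ¬ ((L + M : ℝ≥0) : ℝ) ≤ L := by
        simpa using pos_iff_ne_zero.2 hM
      simp only [if_neg this]
      simp

theorem lengthEDist_le {Z : Type*} [EMetricSpace Z] {x y : Z} (h : LipJoined x y L) :
    lengthEDist x y ≤ L := by
  obtain ⟨γ, hγ, rfl, rfl⟩ := h
  refine iInf_le_of_le 0 (iInf_le_of_le L (iInf_le_of_le γ
    (iInf_le_of_le ⟨L.2, hγ.continuous.continuousOn, rfl, rfl⟩ ?_)))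
  have := (hγ.lipschitzOnWith (s := univ)).comp_eVariationOn_le (f := γ) (g := id)
    (s := Icc 0 (L : ℝ))
    (fun _ _ => mem_univ _)
  rw [eVariationOn_id_Icc] at this
  simpa using this

end LipJoined

theorem IsLengthSpace.lengthEDist_eq {Z : Type*} [EMetricSpace Z] (hZ : IsLengthSpace Z) (x y : Z) :
    lengthEDist x y = edist x y := by
  refine le_antisymm ?_ (edist_le_lengthEDist x y)
  refine le_of_forall_gt_imp_ge_of_dense fun c hc => ?_
  obtain ⟨L, hL, hLc⟩ := ENNReal.lt_iff_exists_nnreal_btwn.1 hc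
  exact (hZ x y L hL).lengthEDist_le.trans hLc.le

/-- If the single steps of chains are realized by curves of the right length, so are the chains. -/
theorem lipJoined_of_chainEDist_lt {P Z : Type*} [PseudoEMetricSpace Z] {c : P → P → ℝ≥0∞}
    {φ : P → Z} (hc : ∀ (x y : P) (L : ℝ≥0), c x y < L → LipJoined (φ x) (φ y) L)
    {x y : P} {L : ℝ≥0}
    (h : chainEDist c x y < L) : LipJoined (φ x) (φ y) L := by
  simp only [chainEDist, iInf_lt_iff] at h
  obtain ⟨n, u, rfl, rfl, h⟩ := h
  induction n generalizing L with
  | zero => exact LipJoined.refl _ _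
  | succ n ih =>
    rw [Finset.sum_range_succ] at h
    have h1 := (le_self_add.trans_lt h).trans ENNReal.coe_lt_top
    have h2 := (le_add_self.trans_lt h).trans ENNReal.coe_lt_top
    obtain ⟨a, ha : (a : ℝ≥0∞) = _⟩ := WithTop.ne_top_iff_exists.1 h1.ne
    obtain ⟨b, hb : (b : ℝ≥0∞) = _⟩ := WithTop.ne_top_iff_exists.1 h2.ne
    rw [← ha, ← hb, ← ENNReal.coe_add, ENNReal.coe_lt_coe] at h
    obtain ⟨δ, hδ, hδL⟩ : ∃ δ : ℝ≥0, 0 < δ ∧ (a + δ) + (b + δ) = L := by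
      refine ⟨(L - (a + b)) / 2, by simpa using h, ?_⟩
      have : (L - (a + b)) / 2 + (L - (a + b)) / 2 = L - (a + b) := add_halves _
      rw [add_add_add_comm, this, add_tsub_cancel_of_le h.le]
    rw [← hδL]
    refine (ih ?_).trans (hc _ _ _ ?_)
    · rw [← ha, ENNReal.coe_lt_coe]
      exact lt_add_of_pos_right _ hδ
    · rw [← hb, ENNReal.coe_lt_coe]
      exact lt_add_of_pos_right _ hδ

theorem edist_withLp_two {Z W : Type*} [EMetricSpace Z] [EMetricSpace W] (p q : WithLp 2 (Z × W)) :
    edist p q = (edist p.fst q.fst ^ 2 + edist p.snd q.snd ^ 2) ^ (1 / 2 : ℝ) := by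
  rw [WithLp.prod_edist_eq_add (by norm_num)]
  norm_num

/-- The product of a length space with an interval is a length space. -/
theorem IsLengthSpace.withLp_prod {Z : Type*} [EMetricSpace Z] (hZ : IsLengthSpace Z) {I : Set ℝ}
    (hI : Convex ℝ I) : IsLengthSpace (WithLp 2 (Z × I)) := by
  intro p q L hL
  rw [edist_withLp_two] at hL
  set a : ℝ := (q.snd : ℝ) - p.snd with ha
  have hea : edist p.snd q.snd = ENNReal.ofReal |a| := by
    rw [Subtype.edist_eq, edist_comm, edist_dist, Real.dist_eq]
  have hL2 : edist p.fst q.fst ^ 2 + ENNReal.ofReal (a ^ 2) < ENNReal.ofReal (L ^ 2 : ℝ) := by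
    have h := ENNReal.rpow_lt_rpow hL two_pos
    rw [← ENNReal.rpow_mul] at h
    norm_num at h
    rw [hea, ← ENNReal.ofReal_pow (abs_nonneg a), sq_abs] at h
    rwa [ENNReal.ofReal_pow L.coe_nonneg, ENNReal.ofReal_coe_nnreal]
  have haL : a ^ 2 < (L : ℝ) ^ 2 :=
    (ENNReal.ofReal_lt_ofReal_iff_of_nonneg (sq_nonneg a)).1 (le_add_self.trans_lt hL2)
  have hL0 : (0 : ℝ) < L := lt_of_le_of_ne L.2 fun h0 => by
    rw [← h0] at haL
    nlinarith [sq_nonneg a]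
  -- the length available in the first factor
  obtain ⟨M, hM⟩ : ∃ M : ℝ≥0, (M : ℝ) ^ 2 + a ^ 2 = (L : ℝ) ^ 2 :=
    ⟨⟨√((L : ℝ) ^ 2 - a ^ 2), Real.sqrt_nonneg _⟩, by
      change √((L : ℝ) ^ 2 - a ^ 2) ^ 2 + _ = _
      rw [Real.sq_sqrt (by linarith)]
      ring⟩
  have hpM : edist p.fst q.fst < M := by
    rw [← hM, ENNReal.ofReal_add (sq_nonneg _) (sq_nonneg _)] at hL2
    have h := lt_of_add_lt_add_right hL2
    rw [ENNReal.ofReal_pow M.coe_nonneg, ENNReal.ofReal_coe_nnreal] at h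
    exact lt_of_not_ge fun hle => h.not_ge (pow_le_pow_left' hle 2)
  obtain ⟨γ, hγ, hγ0, hγM⟩ := hZ _ _ M hpM
  have hmem : ∀ s : ℝ, (p.snd : ℝ) + (projIcc (0 : ℝ) 1 zero_le_one (s / L) : ℝ) * a ∈ I := by
    intro s
    have hθ := (projIcc (0 : ℝ) 1 zero_le_one (s / L)).2
    have := hI.add_smul_sub_mem p.snd.2 q.snd.2 hθ
    simpa [ha] using this
  refine ⟨fun s => WithLp.toLp 2 (γ (M * (projIcc (0 : ℝ) 1 zero_le_one (s / L) : ℝ)),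
    ⟨_, hmem s⟩), ?_, ?_, ?_⟩
  · intro s t
    rw [ENNReal.coe_one, one_mul, edist_withLp_two]
    set θ : ℝ := (projIcc (0 : ℝ) 1 zero_le_one (s / L) : ℝ)
    set τ : ℝ := (projIcc (0 : ℝ) 1 zero_le_one (t / L) : ℝ)
    have hθτ : |θ - τ| ≤ |s - t| / L := by
      have h : |θ - τ| ≤ |s / L - t / L| := by
        have := (LipschitzWith.projIcc (zero_le_one (α := ℝ))).dist_le_mul (s / L) (t / L)
        simpa [Real.dist_eq, Subtype.dist_eq] using this
      rwa [← sub_div, abs_div, abs_of_pos hL0] at h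
    have e1 : edist (γ (M * θ)) (γ (M * τ)) ≤ ENNReal.ofReal (M * |θ - τ|) := by
      refine (hγ _ _).trans (le_of_eq ?_)
      rw [ENNReal.coe_one, one_mul, edist_dist, Real.dist_eq, ← mul_sub, abs_mul,
        abs_of_nonneg M.coe_nonneg]
    have e2 : edist (⟨_, hmem s⟩ : I) ⟨_, hmem t⟩ = ENNReal.ofReal (|a| * |θ - τ|) := by
      rw [Subtype.edist_eq, edist_dist, Real.dist_eq, add_sub_add_left_eq_sub, ← sub_mul, abs_mul,
        mul_comm]
    calc (edist (γ (M * θ)) (γ (M * τ)) ^ 2 + edist (⟨_, hmem s⟩ : I) ⟨_, hmem t⟩ ^ 2) ^ (1 / 2 : ℝ)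
        ≤ (ENNReal.ofReal (M * |θ - τ|) ^ 2 +
            ENNReal.ofReal (|a| * |θ - τ|) ^ 2) ^ (1 / 2 : ℝ) := by
          rw [e2]
          gcongr
      _ = (ENNReal.ofReal (L * |θ - τ|) ^ 2) ^ (1 / 2 : ℝ) := by
          rw [← ENNReal.ofReal_pow (by positivity), ← ENNReal.ofReal_pow (by positivity),
            ← ENNReal.ofReal_pow (by positivity), ← ENNReal.ofReal_add (by positivity)
            (by positivity), mul_pow, mul_pow, mul_pow, sq_abs a, ← add_mul, hM]
      _ = ENNReal.ofReal (L * |θ - τ|) := by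
          rw [← ENNReal.rpow_natCast, ← ENNReal.rpow_mul]
          norm_num
      _ ≤ edist s t := by
          rw [edist_dist, Real.dist_eq]
          refine ENNReal.ofReal_le_ofReal ?_
          rw [le_div_iff₀ hL0] at hθτ
          linarith
  · have : projIcc (0 : ℝ) 1 zero_le_one (0 / L) = ⟨0, by simp⟩ := by simp
    refine (WithLp.equiv 2 (Z × I)).injective (Prod.ext ?_ (Subtype.ext ?_))
    · simp [hγ0]
    · simp
  · refine (WithLp.equiv 2 (Z × I)).injective (Prod.ext ?_ (Subtype.ext ?_))
    · simp [hL0.ne', hγM]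
    · simp [hL0.ne', ha]

end LengthSpaces

/-! ### Collapsing a set to a point -/

section Collapse

variable {Z : Type*} [EMetricSpace Z] (E : Set Z)

/-- The projection of `Z` to the quotient metric space `Z / E`. -/
noncomputable def CollapseQuotient.mk (z : Z) : CollapseQuotient Z E :=
  SeparationQuotient.mk (show CollapsePre Z E from z)

theorem CollapseQuotient.mk_surjective : Function.Surjective (CollapseQuotient.mk E) := fun x => by
  obtain ⟨z, rfl⟩ := SeparationQuotient.surjective_mk x
  exact ⟨z, rfl⟩

theorem CollapseQuotient.edist_mk (x y : Z) :
    edist (CollapseQuotient.mk E x) (CollapseQuotient.mk E y) =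
      chainEDist (fun x y : Z => min (edist x y) (⨅ (_ : x ∈ E ∧ y ∈ E), 0)) x y :=
  SeparationQuotient.edist_mk (X := CollapsePre Z E) x y

theorem CollapseQuotient.edist_mk_le (x y : Z) :
    edist (CollapseQuotient.mk E x) (CollapseQuotient.mk E y) ≤ edist x y := by
  rw [CollapseQuotient.edist_mk]
  exact (chainEDist_le _ _ _).trans (min_le_left _ _)

theorem CollapseQuotient.mk_eq_of_mem {x y : Z} (hx : x ∈ E) (hy : y ∈ E) :
    CollapseQuotient.mk E x = CollapseQuotient.mk E y := by
  rw [← edist_le_zero, CollapseQuotient.edist_mk]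
  refine (chainEDist_le _ _ _).trans ((min_le_right _ _).trans ?_)
  exact iInf_le_of_le ⟨hx, hy⟩ le_rfl

/-- In a chain one either never jumps, or first has to reach `E` and in the end leaves it. -/
theorem CollapseQuotient.le_edist_mk (x y : Z) :
    min (edist x y) (Metric.infEDist x E + Metric.infEDist y E) ≤
      edist (CollapseQuotient.mk E x) (CollapseQuotient.mk E y) := by
  rw [CollapseQuotient.edist_mk]
  refine le_chainEDist (d := fun x y : Z =>
    min (edist x y) (Metric.infEDist x E + Metric.infEDist y E)) (by simp) ?_ ?_ x y
  · intro x y z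
    have hxy : Metric.infEDist x E ≤ edist x y + Metric.infEDist y E :=
      Metric.infEDist_le_edist_add_infEDist
    have hzy : Metric.infEDist z E ≤ edist y z + Metric.infEDist y E := by
      rw [edist_comm]
      exact Metric.infEDist_le_edist_add_infEDist
    rw [min_add, add_min, add_min]
    refine le_min (le_min ?_ ?_) (le_min ?_ ?_)
    · exact (min_le_left _ _).trans (edist_triangle x y z)
    · refine (min_le_right _ _).trans ((add_le_add_left hxy _).trans (le_of_eq ?_))
      rw [add_assoc]
    · refine (min_le_right _ _).trans ((add_le_add_right hzy _).trans (le_of_eq ?_))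
      ring
    · refine (min_le_right _ _).trans (add_le_add le_self_add ?_)
      exact le_add_self
  · intro x y
    refine le_min (min_le_left _ _) (le_iInf fun h => ?_)
    simp [Metric.infEDist_zero_of_mem h.1, Metric.infEDist_zero_of_mem h.2]

variable {E}

theorem CollapseQuotient.edist_mk_eq {x y : Z}
    (h : edist x y ≤ Metric.infEDist x E + Metric.infEDist y E) :
    edist (CollapseQuotient.mk E x) (CollapseQuotient.mk E y) = edist x y :=
  le_antisymm (CollapseQuotient.edist_mk_le E x y)
    ((min_eq_left h).symm.trans_le (CollapseQuotient.le_edist_mk E x y))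

theorem CollapseQuotient.mk_eq_iff (hE : IsClosed E) {x y : Z} :
    CollapseQuotient.mk E x = CollapseQuotient.mk E y ↔ x = y ∨ (x ∈ E ∧ y ∈ E) := by
  refine ⟨fun h => ?_, ?_⟩
  · have h0 := CollapseQuotient.le_edist_mk E x y
    rw [h, edist_self, nonpos_iff_eq_zero, ← bot_eq_zero, min_eq_bot] at h0
    rcases h0 with h0 | h0
    · exact Or.inl (edist_eq_zero.1 h0)
    · rw [bot_eq_zero, add_eq_zero, ← Metric.mem_closure_iff_infEDist_zero,
        ← Metric.mem_closure_iff_infEDist_zero, hE.closure_eq] at h0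
      exact Or.inr h0
  · rintro (rfl | ⟨hx, hy⟩)
    · rfl
    · exact CollapseQuotient.mk_eq_of_mem E hx hy

theorem IsLengthSpace.collapseQuotient (hZ : IsLengthSpace Z) :
    IsLengthSpace (CollapseQuotient Z E) := by
  intro x y L hL
  obtain ⟨x, rfl⟩ := CollapseQuotient.mk_surjective E x
  obtain ⟨y, rfl⟩ := CollapseQuotient.mk_surjective E y
  rw [CollapseQuotient.edist_mk] at hL
  refine lipJoined_of_chainEDist_lt (P := Z) (φ := CollapseQuotient.mk E) (fun x y L h => ?_) hL
  rcases min_lt_iff.1 h with h | h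
  · refine (hZ x y L h).map fun p q => ?_
    rw [ENNReal.coe_one, one_mul]
    exact CollapseQuotient.edist_mk_le E p q
  · obtain ⟨h, -⟩ := iInf_lt_iff.1 h
    rw [CollapseQuotient.mk_eq_of_mem E h.1 h.2]
    exact LipJoined.refl _ _

end Collapse

/-! ### The surface `Y` -/

theorem LipschitzWith.lipJoined {Z : Type*} [EMetricSpace Z] {c : NNReal} {g : Icc (0 : ℝ) 1 → Z}
    (hg : LipschitzWith c g) : LipJoined (g 0) (g 1) c := by
  by_cases hc : c = 0
  · have : g 0 = g 1 := by
      rw [← edist_le_zero]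
      simpa [hc] using hg 0 1
    rw [this]
    exact LipJoined.refl _ _
  · refine ⟨fun r => g (projIcc 0 1 zero_le_one (r / c)), ?_, ?_, ?_⟩
    · have h1 : LipschitzWith c⁻¹ (fun r : ℝ => r / c) := LipschitzWith.of_dist_le_mul fun r s => by
        rw [Real.dist_eq, Real.dist_eq, ← sub_div, abs_div, div_eq_inv_mul, NNReal.coe_inv,
          abs_of_nonneg c.coe_nonneg]
      have h2 := hg.comp ((LipschitzWith.projIcc (zero_le_one (α := ℝ))).comp h1)
      rw [one_mul, mul_inv_cancel₀ hc] at h2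
      exact h2
    · simp
    · simp [hc]

namespace CuspSpace

theorem Slit.t_pos (k : Slit) : 0 < k.t := by
  have : 0 < k.i := k.odd_i.pos
  unfold Slit.t
  positivity

theorem edist_mk_le_of_step {x y : Piece} {c : ℝ≥0∞} (h : Step x y c) :
    edist (SeparationQuotient.mk x : Y) (SeparationQuotient.mk y) ≤ c := by
  rw [SeparationQuotient.edist_mk]
  exact (chainEDist_le _ _ _).trans (iInf₂_le c h)

theorem mk_eq_mk_of_step {x y : Piece} (h : Step x y 0) :
    (SeparationQuotient.mk x : Y) = SeparationQuotient.mk y :=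
  edist_le_zero.1 (edist_mk_le_of_step h)

/-- A point of a segment, approached from the side of the starting point if it is
not the endpoint, lies on the same side of a vertical line as the two endpoints. -/
theorem liesLeft_iff_of_liesLeft_iff {r : ℝ} {σ τ : Side} {a b s : ℝ}
    (h : LiesLeft r σ a ↔ LiesLeft r τ b) (hs0 : 0 ≤ s) (hs1 : s ≤ 1) [Decidable (s < 1)] :
    LiesLeft r (if s < 1 then σ else τ) (a + s * (b - a)) ↔ LiesLeft r σ a := by
  split_ifs with hs
  · by_cases hl : LiesLeft r σ a
    · have hl' := h.1 hl
      refine iff_of_true ?_ hl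
      unfold LiesLeft at hl hl' ⊢
      have hb : b ≤ r := by
        rcases hl' with h | h
        exacts [h.le, h.1.le]
      rcases hl with h | ⟨rfl, hσ⟩
      · left
        nlinarith
      · have : a + s * (b - a) ≤ a := by nlinarith
        rcases this.lt_or_eq with h' | h'
        exacts [Or.inl h', Or.inr ⟨h', hσ⟩]
    · have hl' := mt h.2 hl
      refine iff_of_false ?_ hl
      unfold LiesLeft at hl hl' ⊢
      push Not at hl hl' ⊢
      have hlt := hl.1
      have hbt := hl'.1
      refine ⟨by nlinarith, fun he => hl.2 (le_antisymm ?_ hlt)⟩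
      by_contra hcon
      push Not at hcon
      nlinarith
  · have : s = 1 := le_antisymm hs1 (not_lt.1 hs)
    subst this
    rw [h]
    simp

theorem NotBlocked.lineMap {k : Slit} {σ τ : Side} {p q : Plane} (h : NotBlocked k σ τ p q)
    {s t : ℝ} (hs : s ∈ Icc (0 : ℝ) 1) (ht : t ∈ Icc (0 : ℝ) 1)
    [Decidable (s < 1)] [Decidable (t < 1)] :
    NotBlocked k (if s < 1 then σ else τ) (if t < 1 then σ else τ)
      (AffineMap.lineMap p q s) (AffineMap.lineMap p q t) := by
  rcases h with h | h
  · left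
    have e : ∀ s : ℝ, (AffineMap.lineMap p q s : Plane) 0 = p 0 + s * (q 0 - p 0) := fun s => by
      simp [AffineMap.lineMap_apply]
      ring
    rw [e, e, liesLeft_iff_of_liesLeft_iff h hs.1 hs.2, liesLeft_iff_of_liesLeft_iff h ht.1 ht.2]
  · right
    refine h.mono_left ((convex_segment p q).segment_subset ?_ ?_)
    · exact segment_eq_image_lineMap ℝ p q ▸ mem_image_of_mem _ hs
    · exact segment_eq_image_lineMap ℝ p q ▸ mem_image_of_mem _ ht

/-- A family of segment steps between the points of a segment gives a curve of the right length. -/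
theorem lipJoined_of_step_lineMap {p q : Plane} {g : Icc (0 : ℝ) 1 → Piece}
    (hg : ∀ s t, Step (g s) (g t)
      (edist (AffineMap.lineMap p q (s : ℝ) : Plane) (AffineMap.lineMap p q (t : ℝ))))
    {L : NNReal} (hL : edist p q ≤ L) :
    LipJoined (SeparationQuotient.mk (g 0) : Y) (SeparationQuotient.mk (g 1)) L := by
  have : LipschitzWith (nndist p q) (fun s => (SeparationQuotient.mk (g s) : Y)) := by
    intro s t
    refine (edist_mk_le_of_step (hg s t)).trans ?_
    exact lipschitzWith_lineMap (𝕜 := ℝ) p q (s : ℝ) (t : ℝ)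
  refine this.lipJoined.mono ?_
  rwa [edist_nndist, ENNReal.coe_le_coe] at hL

theorem Slit.convex_square (k : Slit) : Convex ℝ k.square := by
  intro p hp q hq a b ha hb hab
  exact ⟨convex_Icc 0 k.side hp.1 hq.1 ha hb hab, convex_Icc 0 k.side hp.2 hq.2 ha hb hab⟩

theorem Step.lipJoined {x y : Piece} {c : ℝ≥0∞} (h : Step x y c) {L : NNReal} (hL : c ≤ L) :
    LipJoined (SeparationQuotient.mk x : Y) (SeparationQuotient.mk y) L := by
  have hmem : ∀ (p q : Plane) (s : Icc (0 : ℝ) 1), (AffineMap.lineMap p q (s : ℝ) : Plane) ∈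
      segment ℝ p q := fun p q s => segment_eq_image_lineMap ℝ p q ▸ mem_image_of_mem _ s.2
  induction h generalizing L with
  | top σ τ p q hp hq hpq h =>
    classical
    have := lipJoined_of_step_lineMap (g := fun s => Piece.top (if (s : ℝ) < 1 then σ else τ)
      (AffineMap.lineMap p q (s : ℝ)) (hpq (hmem p q s))) (fun s t => Step.top _ _ _ _ _ _
        (((convex_segment p q).segment_subset (hmem p q s) (hmem p q t)).trans hpq)
        (fun k => (h k).lineMap s.2 t.2)) hL
    simpa using this
  | bottom p q hp hq hpq =>
    have := lipJoined_of_step_lineMap (g := fun s => Piece.bottom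
      (AffineMap.lineMap p q (s : ℝ)) (hpq (hmem p q s))) (fun s t => Step.bottom _ _ _ _
        (((convex_segment p q).segment_subset (hmem p q s) (hmem p q t)).trans hpq)) hL
    simpa using this
  | face k σ p q hp hq =>
    have := lipJoined_of_step_lineMap (g := fun s => Piece.face k σ
      (AffineMap.lineMap p q (s : ℝ)) (k.convex_square.segment_subset hp hq (hmem p q s)))
      (fun s t => Step.face _ _ _ _ _ _) hL
    simpa using this
  | double σ p hp h =>
    rw [mk_eq_mk_of_step (.double σ p hp h)]
    exact LipJoined.refl _ _
  | rim k p hp h =>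
    rw [mk_eq_mk_of_step (.rim k p hp h)]
    exact LipJoined.refl _ _
  | slit k σ p q hp hq hI hJ =>
    rw [mk_eq_mk_of_step (.slit k σ p q hp hq hI hJ)]
    exact LipJoined.refl _ _
  | symm x y c h ih => exact (ih hL).symm

theorem isLengthSpace_Y : IsLengthSpace Y := by
  intro x y L hL
  obtain ⟨x, rfl⟩ := SeparationQuotient.surjective_mk x
  obtain ⟨y, rfl⟩ := SeparationQuotient.surjective_mk y
  rw [SeparationQuotient.edist_mk] at hL
  refine lipJoined_of_chainEDist_lt (φ := fun x => (SeparationQuotient.mk x : Y))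
    (fun x y L h => ?_) hL
  simp only [stepCost, iInf_lt_iff] at h
  obtain ⟨c, h, hc⟩ := h
  exact h.lipJoined hc.le

theorem isLengthSpace_X : IsLengthSpace X := isLengthSpace_Y.withLp_prod (convex_Ioo _ _)

/-! ### The coordinate `t` on `Y` -/

/-- The coordinate `t` of a point of a piece; it is constant on each pillowcase. -/
noncomputable def Piece.t : Piece → ℝ
  | .top _ p _ => p 0
  | .bottom p _ => p 0
  | .face k _ _ _ => k.t

theorem edist_coord_le (p q : Plane) (i : Fin 2) : edist (p i) (q i) ≤ edist p q :=
  PiLp.edist_apply_le p q i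

theorem Step.edist_t_le {x y : Piece} {c : ℝ≥0∞} (h : Step x y c) : edist x.t y.t ≤ c := by
  induction h with
  | top σ τ p q hp hq hpq h => exact edist_coord_le p q 0
  | bottom p q hp hq hpq => exact edist_coord_le p q 0
  | face k σ p q hp hq => simp [Piece.t]
  | double σ p hp h => simp [Piece.t]
  | rim k p hp h => simp [Piece.t]
  | slit k σ p q hp hq hI hJ => simp [Piece.t, hI.1]
  | symm x y c h ih => rwa [edist_comm]

theorem edist_t_le (x y : Piece) : edist x.t y.t ≤ edist x y :=
  edist_le_chainEDist (fun _ _ => le_iInf₂ fun _ h => h.edist_t_le) x y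

/-- The coordinate `t` on `Y`. -/
noncomputable def tCoord : Y → ℝ :=
  SeparationQuotient.lift Piece.t fun x y h => by
    have := edist_t_le x y
    rwa [EMetric.inseparable_iff.1 h, nonpos_iff_eq_zero, edist_eq_zero] at this

theorem lipschitzWith_tCoord : LipschitzWith 1 tCoord := by
  intro x y
  obtain ⟨x, rfl⟩ := SeparationQuotient.surjective_mk x
  obtain ⟨y, rfl⟩ := SeparationQuotient.surjective_mk y
  rw [ENNReal.coe_one, one_mul]
  exact edist_t_le x y

theorem Slit.t_lt_one (k : Slit) : k.t < 1 := by
  unfold Slit.t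
  rw [div_lt_one (by positivity)]
  exact_mod_cast k.i_lt

theorem tCoord_nonneg (y : Y) : 0 ≤ tCoord y := by
  obtain ⟨y, rfl⟩ := SeparationQuotient.surjective_mk y
  cases y with
  | top σ p hp => exact hp.1
  | bottom p hp => exact hp.1
  | face k σ q hq => exact k.t_pos.le

theorem tCoord_lt_one (y : Y) : tCoord y < 1 := by
  obtain ⟨y, rfl⟩ := SeparationQuotient.surjective_mk y
  cases y with
  | top σ p hp => exact hp.2.1
  | bottom p hp => exact hp.2.1
  | face k σ q hq => exact k.t_lt_one

theorem eq_zero_of_mem_Y₀ {p : Plane} (hp : p ∈ Y₀) (h : p 0 = 0) : p = 0 := by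
  have h1 : p 1 = 0 := le_antisymm (by simpa [f, h] using hp.2.2.2) hp.2.2.1
  ext i
  fin_cases i
  exacts [h, h1]

theorem top_zero_eq_cusp (σ : Side) :
    (SeparationQuotient.mk (Piece.top σ 0 zero_mem_Y₀) : Y) = cusp := by
  refine edist_le_zero.1 ((edist_mk_le_of_step
    (.top σ .left 0 0 zero_mem_Y₀ zero_mem_Y₀ ?_ ?_)).trans (edist_self _).le)
  · simpa using zero_mem_Y₀
  · intro k
    right
    simp only [segment_same, disjoint_singleton_left]
    exact fun h => k.t_pos.ne h.1

theorem tCoord_eq_zero_iff {y : Y} : tCoord y = 0 ↔ y = cusp := by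
  refine ⟨fun h => ?_, fun h => by rw [h]; rfl⟩
  obtain ⟨y, rfl⟩ := SeparationQuotient.surjective_mk y
  cases y with
  | top σ p hp =>
    obtain rfl := eq_zero_of_mem_Y₀ hp h
    exact top_zero_eq_cusp σ
  | bottom p hp =>
    obtain rfl := eq_zero_of_mem_Y₀ hp h
    rw [← top_zero_eq_cusp .left]
    exact (mk_eq_mk_of_step (.double .left 0 hp (Or.inl rfl))).symm
  | face k σ q hq => exact absurd h k.t_pos.ne'

/-- The coordinates `t` at which slits are attached: the dyadic rationals in `(0, 1)`. -/
def slitCoords : Set ℝ := range Slit.t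

theorem countable_slitCoords : slitCoords.Countable := by
  have : slitCoords ⊆ range fun x : ℕ × ℕ => (x.1 : ℝ) / 2 ^ x.2 := by
    rintro _ ⟨k, rfl⟩
    exact ⟨(k.i, k.m), rfl⟩
  exact (countable_range _).mono this

theorem zero_notMem_slitCoords : (0 : ℝ) ∉ slitCoords := by
  rintro ⟨k, hk⟩
  exact k.t_pos.ne' hk

end CuspSpace

/-! ### Hausdorff measure near the cusp -/

namespace CuspSpace

open Filter Topology

theorem edist_vertical (p : Plane) (m : ℝ) : edist p !₂[p 0, m] = ENNReal.ofReal |p 1 - m| := by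
  rw [edist_dist, EuclideanSpace.dist_eq]
  simp [Fin.sum_univ_two, Real.sqrt_sq_eq_abs, Real.dist_eq]

theorem edist_horizontal (a b m : ℝ) :
    edist (!₂[a, m] : Plane) !₂[b, m] = ENNReal.ofReal |a - b| := by
  rw [edist_dist, EuclideanSpace.dist_eq]
  simp [Fin.sum_univ_two, Real.sqrt_sq_eq_abs, Real.dist_eq]

theorem vertical_mem_Y₀ {p : Plane} (hp : p ∈ Y₀) {m : ℝ} (hm : 0 ≤ m) (hmp : m ≤ p 1) :
    (!₂[p 0, m] : Plane) ∈ Y₀ :=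
  ⟨hp.1, hp.2.1, hm, hmp.trans hp.2.2.2⟩

theorem segment_vertical_subset {p : Plane} (hp : p ∈ Y₀) {m : ℝ} (hm : 0 ≤ m) (hmp : m ≤ p 1) :
    segment ℝ p !₂[p 0, m] ⊆ Y₀ := by
  rintro _ ⟨a, b, ha, hb, hab, rfl⟩
  obtain ⟨h1, h2, h3, h4⟩ := hp
  have e0 : (a • p + b • (!₂[p 0, m] : Plane)) 0 = p 0 := by
    simp [← add_mul, hab]
  have e1 : (a • p + b • (!₂[p 0, m] : Plane)) 1 = a * p 1 + b * m := by simp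
  refine ⟨?_, ?_, ?_, ?_⟩
  · rwa [e0]
  · rwa [e0]
  · rw [e1]
    positivity
  · rw [e0, e1]
    have : b * m ≤ b * p 1 := by gcongr
    calc a * p 1 + b * m ≤ (a + b) * p 1 := by linarith
      _ ≤ f (p 0) := by rwa [hab, one_mul]

theorem segment_horizontal_apply_one {a b m : ℝ} {z : Plane}
    (hz : z ∈ segment ℝ (!₂[a, m] : Plane) !₂[b, m]) : z 1 = m := by
  obtain ⟨α, β, -, -, hab, rfl⟩ := hz
  simp [← add_mul, hab]

theorem f_mono {a b : ℝ} (ha : 0 ≤ a) (hab : a ≤ b) : f a ≤ f b := by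
  unfold f
  gcongr

theorem segment_horizontal_subset {a b m : ℝ} (ha : (!₂[a, m] : Plane) ∈ Y₀)
    (hb : (!₂[b, m] : Plane) ∈ Y₀) : segment ℝ (!₂[a, m] : Plane) !₂[b, m] ⊆ Y₀ := by
  intro z hz
  have hz1 := segment_horizontal_apply_one hz
  obtain ⟨α, β, hα, hβ, hab, rfl⟩ := hz
  have e0 : (α • (!₂[a, m] : Plane) + β • !₂[b, m]) 0 = α • a + β • b := by simp
  have hmem : α • a + β • b ∈ Ico (0 : ℝ) 1 :=
    (convex_Ico 0 1) ⟨ha.1, ha.2.1⟩ ⟨hb.1, hb.2.1⟩ hα hβ hab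
  refine ⟨?_, ?_, ?_, ?_⟩
  · rw [e0]
    exact hmem.1
  · rw [e0]
    exact hmem.2
  · rw [hz1]
    exact ha.2.2.1
  · rw [hz1, e0]
    have hmin : min a b ≤ α • a + β • b := by
      have h1 : α • min a b ≤ α • a := by
        simp only [smul_eq_mul]
        gcongr
        exact min_le_left _ _
      have h2 : β • min a b ≤ β • b := by
        simp only [smul_eq_mul]
        gcongr
        exact min_le_right _ _
      calc min a b = α • min a b + β • min a b := by rw [← add_smul, hab, one_smul]
        _ ≤ _ := add_le_add h1 h2
    refine le_trans ?_ (f_mono (show 0 ≤ min a b from le_min ha.1 hb.1) hmin)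
    rcases min_choice a b with h | h <;> rw [h]
    exacts [ha.2.2.2, hb.2.2.2]

/-- Two points of the top copy of `Y₀` can be joined by going down to height `m`, then
horizontally, then up again, if no slit is in the way at height `m`. -/
theorem edist_top_le {σ τ : Side} {p q : Plane} (hp : p ∈ Y₀) (hq : q ∈ Y₀) {m : ℝ} (hm : 0 ≤ m)
    (hmp : m ≤ p 1) (hmq : m ≤ q 1) (h : ∀ k, NotBlocked k σ τ !₂[p 0, m] !₂[q 0, m]) :
    edist (SeparationQuotient.mk (.top σ p hp) : Y) (SeparationQuotient.mk (.top τ q hq)) ≤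
      ENNReal.ofReal (p 1 - m) + ENNReal.ofReal |p 0 - q 0| + ENNReal.ofReal (q 1 - m) := by
  have hp' := vertical_mem_Y₀ hp hm hmp
  have hq' := vertical_mem_Y₀ hq hm hmq
  have h1 := edist_mk_le_of_step (.top σ σ p _ hp hp' (segment_vertical_subset hp hm hmp)
    fun k => Or.inl (by simp))
  have h2 := edist_mk_le_of_step (.top σ τ _ _ hp' hq' (segment_horizontal_subset hp' hq') h)
  have h3 := edist_mk_le_of_step (.top τ τ q _ hq hq' (segment_vertical_subset hq hm hmq)
    fun k => Or.inl (by simp))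
  rw [edist_vertical, abs_of_nonneg (sub_nonneg.2 hmp)] at h1
  rw [edist_horizontal] at h2
  rw [edist_vertical, abs_of_nonneg (sub_nonneg.2 hmq), edist_comm] at h3
  exact (edist_triangle4 _ _ _ _).trans (add_le_add (add_le_add h1 h2) h3)

theorem edist_bottom_le {p q : Plane} (hp : p ∈ Y₀) (hq : q ∈ Y₀) {m : ℝ} (hm : 0 ≤ m)
    (hmp : m ≤ p 1) (hmq : m ≤ q 1) :
    edist (SeparationQuotient.mk (.bottom p hp) : Y) (SeparationQuotient.mk (.bottom q hq)) ≤
      ENNReal.ofReal (p 1 - m) + ENNReal.ofReal |p 0 - q 0| + ENNReal.ofReal (q 1 - m) := by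
  have hp' := vertical_mem_Y₀ hp hm hmp
  have hq' := vertical_mem_Y₀ hq hm hmq
  have h1 := edist_mk_le_of_step (.bottom p _ hp hp' (segment_vertical_subset hp hm hmp))
  have h2 := edist_mk_le_of_step (.bottom _ _ hp' hq' (segment_horizontal_subset hp' hq'))
  have h3 := edist_mk_le_of_step (.bottom q _ hq hq' (segment_vertical_subset hq hm hmq))
  rw [edist_vertical, abs_of_nonneg (sub_nonneg.2 hmp)] at h1
  rw [edist_horizontal] at h2
  rw [edist_vertical, abs_of_nonneg (sub_nonneg.2 hmq), edist_comm] at h3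
  exact (edist_triangle4 _ _ _ _).trans (add_le_add (add_le_add h1 h2) h3)

/-- Slits of level at most `M` do not meet the open column over `(i / 2 ^ M, (i + 1) / 2 ^ M)`, and
slits of a higher level are shorter than `1 / 2 ^ M`. -/
theorem notBlocked_of_mem_column {M i : ℕ} {a b m : ℝ} {σ τ : Side} (k : Slit)
    (ha : a ∈ Ico ((i : ℝ) / 2 ^ M) ((i + 1) / 2 ^ M)) (ha' : a ∉ slitCoords)
    (hb : b ∈ Ico ((i : ℝ) / 2 ^ M) ((i + 1) / 2 ^ M)) (hb' : b ∉ slitCoords)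
    (hm : m = 0 ∨ 1 / 2 ^ M ≤ m) : NotBlocked k σ τ !₂[a, m] !₂[b, m] := by
  have h2M : (0 : ℝ) < 2 ^ M := by positivity
  rcases le_or_gt k.m M with hk | hk
  · left
    have key : ∀ (σ : Side) (c : ℝ), c ∈ Ico ((i : ℝ) / 2 ^ M) ((i + 1) / 2 ^ M) →
        c ∉ slitCoords → (LiesLeft k.t σ c ↔ i + 1 ≤ k.i * 2 ^ (M - k.m)) := by
      intro σ c hc hc'
      have hne : c ≠ k.t := fun h => hc' ⟨k, h.symm⟩
      have ht : k.t = ((k.i * 2 ^ (M - k.m) : ℕ) : ℝ) / 2 ^ M := by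
        have : (2 : ℝ) ^ M = 2 ^ k.m * 2 ^ (M - k.m) := by rw [← pow_add, Nat.add_sub_cancel' hk]
        rw [this]
        unfold Slit.t
        push_cast
        field_simp
      simp only [LiesLeft, hne, false_and, or_false]
      rw [ht]
      constructor
      · intro h
        have := (div_lt_div_iff_of_pos_right h2M).1 (hc.1.trans_lt h)
        exact_mod_cast this
      · intro h
        refine hc.2.trans_le ((div_le_div_iff_of_pos_right h2M).2 ?_)
        exact_mod_cast h
    change LiesLeft k.t σ a ↔ LiesLeft k.t τ b
    rw [key σ a ha ha', key τ b hb hb']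
  · right
    refine disjoint_left.2 fun z hz hz' => ?_
    have hz1 := segment_horizontal_apply_one hz
    obtain ⟨-, h0, hl⟩ := hz'
    rw [hz1] at h0 hl
    rcases hm with hm | hm
    · exact h0.ne' hm
    · have : k.len ≤ 1 / 2 ^ M := by
        refine (min_le_left _ _).trans ?_
        rw [Slit.side, one_div]
        gcongr
        norm_num
      linarith

/-- A cell of `Y` of size `2 ^ (-M)`: the part, away from the coordinates of slits, of the top copy
(if `b = true`) or of the bottom copy (if `b = false`) of `Y₀` that lies over a square of a
dyadic grid. -/
def cell (M : ℕ) (b : Bool) (i l : ℕ) : Set Y :=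
  {y | ∃ (p : Plane) (hp : p ∈ Y₀), p 0 ∈ Ico ((i : ℝ) / 2 ^ M) ((i + 1) / 2 ^ M) ∧
    p 0 ∉ slitCoords ∧ p 1 ∈ Ico ((l : ℝ) / 2 ^ M) ((l + 1) / 2 ^ M) ∧
    ((b = true ∧ ∃ σ, y = SeparationQuotient.mk (.top σ p hp)) ∨
      (b = false ∧ y = SeparationQuotient.mk (.bottom p hp)))}

theorem edist_le_of_mem_cell {M : ℕ} {b : Bool} {i l : ℕ} {y z : Y} (hy : y ∈ cell M b i l)
    (hz : z ∈ cell M b i l) : edist y z ≤ ENNReal.ofReal (3 / 2 ^ M) := by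
  obtain ⟨p, hp, hp0, hp0', hp1, hpb⟩ := hy
  obtain ⟨q, hq, hq0, hq0', hq1, hqb⟩ := hz
  have hδ : ((l : ℝ) + 1) / 2 ^ M = l / 2 ^ M + 1 / 2 ^ M := add_div _ _ _
  have hδ' : ((i : ℝ) + 1) / 2 ^ M = i / 2 ^ M + 1 / 2 ^ M := add_div _ _ _
  -- The path runs horizontally along the lower side of the square.  The remaining slits that end in
  -- its column are too short to reach this side, unless it lies on `y = 0`, where nothing is cut.
  have hm : (0 : ℝ) ≤ l / 2 ^ M := by positivity
  have hm' : (l : ℝ) / 2 ^ M = 0 ∨ 1 / 2 ^ M ≤ (l : ℝ) / 2 ^ M := by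
    rcases Nat.eq_zero_or_pos l with h | h
    · left
      simp [h]
    · right
      gcongr
      exact_mod_cast h
  have hsum : ENNReal.ofReal (p 1 - l / 2 ^ M) + ENNReal.ofReal |p 0 - q 0| +
      ENNReal.ofReal (q 1 - l / 2 ^ M) ≤ ENNReal.ofReal (3 / 2 ^ M) := by
    rw [← ENNReal.ofReal_add (by linarith [hp1.1]) (abs_nonneg _),
      ← ENNReal.ofReal_add (by linarith [hp1.1, abs_nonneg (p 0 - q 0)]) (by linarith [hq1.1])]
    refine ENNReal.ofReal_le_ofReal ?_
    have h1 := hp1.2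
    have h2 := hq1.2
    have h3 : |p 0 - q 0| ≤ 1 / 2 ^ M := by
      rw [abs_le]
      constructor <;> linarith [hp0.1, hp0.2, hq0.1, hq0.2]
    have h4 : (3 : ℝ) / 2 ^ M = 1 / 2 ^ M + 1 / 2 ^ M + 1 / 2 ^ M := by ring
    linarith
  rcases hpb with ⟨rfl, σ, rfl⟩ | ⟨rfl, rfl⟩
  · obtain ⟨τ, rfl⟩ : ∃ τ, z = SeparationQuotient.mk (.top τ q hq) := by simpa using hqb
    exact (edist_top_le hp hq hm hp1.1 hq1.1 fun k =>
      notBlocked_of_mem_column k hp0 hp0' hq0 hq0' hm').trans hsum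
  · obtain rfl : z = SeparationQuotient.mk (.bottom q hq) := by simpa using hqb
    exact (edist_bottom_le hp hq hm hp1.1 hq1.1).trans hsum

/-- The part of `X` over the points of `Y` whose coordinate `t` is at most `2 ^ (-j)` and not the
coordinate of a slit. -/
def cuspPart (j : ℕ) : Set X := {x | tCoord x.fst ≤ 1 / 2 ^ j ∧ tCoord x.fst ∉ slitCoords}

/-- The product of a cell with an interval of length `2 ^ (-M)`. -/
def cell₃ (M : ℕ) (b : Bool) (i l n : ℕ) : Set X :=
  {x | x.fst ∈ cell M b i l ∧ (x.snd : ℝ) ∈ Ico (-2 + (n : ℝ) / 2 ^ M) (-2 + (n + 1) / 2 ^ M)}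

theorem ediam_cell₃_le (M : ℕ) (b : Bool) (i l n : ℕ) :
    Metric.ediam (cell₃ M b i l n) ≤ ENNReal.ofReal (4 / 2 ^ M) := by
  refine Metric.ediam_le fun x hx y hy => ?_
  have h1 := edist_le_of_mem_cell hx.1 hy.1
  have h2 : edist x.snd y.snd ≤ ENNReal.ofReal (1 / 2 ^ M) := by
    rw [Subtype.edist_eq, edist_dist, Real.dist_eq]
    refine ENNReal.ofReal_le_ofReal ?_
    have hδ : ((n : ℝ) + 1) / 2 ^ M = n / 2 ^ M + 1 / 2 ^ M := add_div _ _ _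
    rw [abs_le]
    constructor <;> linarith [hx.2.1, hx.2.2, hy.2.1, hy.2.2]
  rw [edist_withLp_two]
  calc (edist x.fst y.fst ^ 2 + edist x.snd y.snd ^ 2) ^ (1 / 2 : ℝ)
      ≤ (ENNReal.ofReal (3 / 2 ^ M) ^ 2 + ENNReal.ofReal (1 / 2 ^ M) ^ 2) ^ (1 / 2 : ℝ) := by
        gcongr
    _ ≤ (ENNReal.ofReal (4 / 2 ^ M) ^ 2) ^ (1 / 2 : ℝ) := by
        rw [← ENNReal.ofReal_pow (by positivity), ← ENNReal.ofReal_pow (by positivity),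
            ← ENNReal.ofReal_pow (by positivity), ← ENNReal.ofReal_add (by positivity)
            (by positivity)]
        gcongr
        rw [div_pow, div_pow, div_pow, ← add_div]
        gcongr
        norm_num
    _ = ENNReal.ofReal (4 / 2 ^ M) := by
        rw [← ENNReal.rpow_natCast, ← ENNReal.rpow_mul]
        norm_num

theorem mem_Ico_floor_div {r : ℝ} (hr : 0 ≤ r) (M : ℕ) :
    r ∈ Ico ((⌊r * 2 ^ M⌋₊ : ℝ) / 2 ^ M) ((⌊r * 2 ^ M⌋₊ + 1) / 2 ^ M) := by
  have h2M : (0 : ℝ) < 2 ^ M := by positivity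
  constructor
  · rw [div_le_iff₀ h2M]
    exact Nat.floor_le (by positivity)
  · rw [lt_div_iff₀ h2M]
    exact Nat.lt_floor_add_one _

theorem floor_lt_of_lt {r : ℝ} (hr : 0 ≤ r) {M N : ℕ} (h : r * 2 ^ M < N) : ⌊r * 2 ^ M⌋₊ < N :=
  (Nat.floor_lt (by positivity)).2 h

/-- The number of cells needed is given by `t ≤ 2 ^ (-j)`, `y ≤ t ^ 3 / 3 < 2 ^ (-3 * j)` and
`-2 < s < 2`.  The factor `2` in the number of columns makes room for the endpoint
`t = 2 ^ (-j)`. -/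
theorem cuspPart_subset {j M : ℕ} (hM : 3 * j ≤ M) :
    cuspPart j ⊆ ⋃ c : Bool × Fin (2 * 2 ^ (M - j)) × Fin (2 ^ (M - 3 * j)) × Fin (4 * 2 ^ M),
      cell₃ M c.1 c.2.1 c.2.2.1 c.2.2.2 := by
  rintro x ⟨hx, hx'⟩
  have h2M : (0 : ℝ) < 2 ^ M := by positivity
  have hs := x.snd.2
  obtain ⟨b, p, hp, hpt, hpb⟩ : ∃ (b : Bool) (p : Plane) (hp : p ∈ Y₀), tCoord x.fst = p 0 ∧
      ((b = true ∧ ∃ σ, x.fst = SeparationQuotient.mk (.top σ p hp)) ∨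
      (b = false ∧ x.fst = SeparationQuotient.mk (.bottom p hp))) := by
    obtain ⟨y, hy⟩ := SeparationQuotient.surjective_mk x.fst
    cases y with
    | top σ p hp => exact ⟨true, p, hp, by rw [← hy]; rfl, Or.inl ⟨rfl, σ, hy.symm⟩⟩
    | bottom p hp => exact ⟨false, p, hp, by rw [← hy]; rfl, Or.inr ⟨rfl, hy.symm⟩⟩
    | face k σ q hq => exact absurd ⟨k, by rw [← hy]; rfl⟩ hx'
  rw [hpt] at hx hx'
  have hp1 : p 1 < 1 / 2 ^ (3 * j) := by
    refine (hp.2.2.2.trans (f_mono hp.1 hx)).trans_lt ?_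
    unfold f
    rw [div_pow, one_pow, ← pow_mul, mul_comm j 3, div_lt_iff₀ (by norm_num)]
    have : (0 : ℝ) < 1 / 2 ^ (3 * j) := by positivity
    linarith
  have hi : ⌊p 0 * 2 ^ M⌋₊ < 2 * 2 ^ (M - j) := by
    refine floor_lt_of_lt hp.1 ?_
    have e : (2 : ℝ) ^ M = 2 ^ j * 2 ^ (M - j) := by rw [← pow_add, Nat.add_sub_cancel' (by omega)]
    have hpos : (0 : ℝ) < 2 ^ (M - j) := by positivity
    rw [le_div_iff₀ (by positivity)] at hx
    rw [e]
    push_cast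
    nlinarith
  have hl : ⌊p 1 * 2 ^ M⌋₊ < 2 ^ (M - 3 * j) := by
    refine floor_lt_of_lt hp.2.2.1 ?_
    have e : (2 : ℝ) ^ M = 2 ^ (3 * j) * 2 ^ (M - 3 * j) := by
      rw [← pow_add, Nat.add_sub_cancel' hM]
    have hpos : (0 : ℝ) < 2 ^ (M - 3 * j) := by positivity
    rw [lt_div_iff₀ (by positivity)] at hp1
    rw [e]
    push_cast
    nlinarith
  have hs0 : 0 ≤ (x.snd : ℝ) + 2 := by linarith [hs.1]
  have hn : ⌊((x.snd : ℝ) + 2) * 2 ^ M⌋₊ < 4 * 2 ^ M := by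
    refine floor_lt_of_lt hs0 ?_
    push_cast
    have := hs.2
    gcongr
    linarith
  refine mem_iUnion.2 ⟨(b, ⟨_, hi⟩, ⟨_, hl⟩, ⟨_, hn⟩), ⟨p, hp, mem_Ico_floor_div hp.1 M, hx',
    mem_Ico_floor_div hp.2.2.1 M, hpb⟩, ?_⟩
  have := mem_Ico_floor_div hs0 M
  constructor <;> linarith [this.1, this.2]

/-- The cusp is so thin that the part of `X` that lies over the two copies of `Y₀` has volume of the
order of `r ^ 4` over `t ≤ r`. -/
theorem hausdorffMeasure_cuspPart_le (j : ℕ) :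
    Measure.hausdorffMeasure 3 (cuspPart j) ≤ ENNReal.ofReal (1024 / 16 ^ j) := by
  have hr : Tendsto (fun M : ℕ => ENNReal.ofReal (4 / 2 ^ M)) atTop (𝓝 0) := by
    rw [← ENNReal.ofReal_zero]
    refine ENNReal.tendsto_ofReal ?_
    have := (tendsto_pow_atTop_nhds_zero_of_lt_one (r := (1 / 2 : ℝ)) (by norm_num)
      (by norm_num)).const_mul 4
    simpa [div_eq_mul_inv] using this
  refine (Measure.hausdorffMeasure_le_liminf_sum (ι := fun M : ℕ => Bool × Fin (2 * 2 ^ (M - j)) ×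
    Fin (2 ^ (M - 3 * j)) × Fin (4 * 2 ^ M)) 3 (cuspPart j) (fun M => ENNReal.ofReal (4 / 2 ^ M)) hr
    (fun M c => cell₃ M c.1 c.2.1 c.2.2.1 c.2.2.2)
    (Eventually.of_forall fun M c => ediam_cell₃_le _ _ _ _ _)
    ((eventually_ge_atTop (3 * j)).mono fun M hM => cuspPart_subset hM)).trans ?_
  refine liminf_le_of_frequently_le' (Eventually.frequently ?_)
  filter_upwards [eventually_ge_atTop (3 * j)] with M hM
  calc _ ≤ ∑ c : Bool × Fin (2 * 2 ^ (M - j)) × Fin (2 ^ (M - 3 * j)) × Fin (4 * 2 ^ M),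
        ENNReal.ofReal ((4 / 2 ^ M) ^ 3) := by
        refine Finset.sum_le_sum fun c _ => ?_
        rw [ENNReal.ofReal_pow (by positivity), ← ENNReal.rpow_natCast]
        exact ENNReal.rpow_le_rpow (ediam_cell₃_le _ _ _ _ _) (by norm_num)
    _ = ENNReal.ofReal (1024 / 16 ^ j) := by
        simp only [Finset.sum_const, Finset.card_univ, Fintype.card_prod, Fintype.card_bool,
          Fintype.card_fin, nsmul_eq_mul]
        rw [← ENNReal.ofReal_natCast, ← ENNReal.ofReal_mul (by positivity)]
        congr 1
        obtain ⟨n, rfl⟩ := Nat.exists_eq_add_of_le hM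
        have e1 : 3 * j + n - j = 2 * j + n := by omega
        have e2 : 3 * j + n - 3 * j = n := by omega
        have e3 : (16 : ℝ) ^ j = (2 ^ j) ^ 4 := by
          rw [← pow_mul, mul_comm, pow_mul]
          norm_num
        rw [e1, e2, e3]
        push_cast
        rw [pow_add, pow_add, mul_comm 3 j, mul_comm 2 j, pow_mul, pow_mul]
        field_simp
        norm_num

/-! ### A function whose integral over curves through the cusp is infinite -/

theorem lipschitzWith_tCoord_fst : LipschitzWith 1 fun x : X => tCoord x.fst := by
  intro x y
  refine (lipschitzWith_tCoord x.fst y.fst).trans ?_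
  gcongr
  exact WithLp.edist_fst_le x y

theorem hausdorffMeasure_tCoord_eq_zero :
    Measure.hausdorffMeasure 3 {x : X | tCoord x.fst = 0} = 0 := by
  have hle : ∀ j : ℕ, Measure.hausdorffMeasure 3 {x : X | tCoord x.fst = 0} ≤
      ENNReal.ofReal (1024 / 16 ^ j) := fun j => by
    refine (measure_mono fun x hx => ?_).trans (hausdorffMeasure_cuspPart_le j)
    have hx : tCoord x.fst = 0 := hx
    refine ⟨?_, by rw [hx]; exact zero_notMem_slitCoords⟩
    rw [hx]
    positivity
  have hlim : Tendsto (fun j : ℕ => ENNReal.ofReal (1024 / 16 ^ j)) atTop (𝓝 0) := by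
    rw [← ENNReal.ofReal_zero]
    refine ENNReal.tendsto_ofReal ?_
    have := (tendsto_pow_atTop_nhds_zero_of_lt_one (r := (1 / 16 : ℝ)) (by norm_num)
      (by norm_num)).const_mul 1024
    simpa [div_eq_mul_inv] using this
  exact le_antisymm (ge_of_tendsto' hlim hle) bot_le

/-- Over `2 ^ (-j - 1) < t ≤ 2 ^ (-j)` the integrand is at most `8 ^ (j + 1)` and the volume is of
order `16 ^ (-j)`. -/
theorem lintegral_invOff_tCoord_lt_top :
    ∫⁻ x : X, invOff slitCoords (tCoord x.fst) ^ (3 : ℝ) ∂(Measure.hausdorffMeasure 3) < ∞ := by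
  set g : X → ℝ≥0∞ := fun x => invOff slitCoords (tCoord x.fst) ^ (3 : ℝ)
  set B : ℕ → Set X := fun j => {x | tCoord x.fst ∈ Ioc ((1 / 2 : ℝ) ^ (j + 1)) ((1 / 2) ^ j) \
    slitCoords} with hB
  have hmeas : Measurable fun x : X => tCoord x.fst :=
    lipschitzWith_tCoord_fst.continuous.measurable
  have hBm : ∀ j, MeasurableSet (B j) := fun j =>
    hmeas (measurableSet_Ioc.diff countable_slitCoords.measurableSet)
  have hBle : ∀ j, ∫⁻ x in B j, g x ∂(Measure.hausdorffMeasure 3) ≤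
      ENNReal.ofReal (8192 * (1 / 2) ^ j) := by
    intro j
    calc ∫⁻ x in B j, g x ∂(Measure.hausdorffMeasure 3)
        ≤ ∫⁻ x in B j, ENNReal.ofReal (8 ^ (j + 1)) ∂(Measure.hausdorffMeasure 3) := by
          refine setLIntegral_mono' (hBm j) fun x hx => ?_
          have hpos : (0 : ℝ) < (1 / 2) ^ (j + 1) := by positivity
          have ht : 0 < tCoord x.fst := hpos.trans hx.1.1
          simp only [g, invOff]
          rw [indicator_of_mem (show tCoord x.fst ∈ slitCoordsᶜ from hx.2),
            ← ENNReal.ofReal_inv_of_pos ht, show (3 : ℝ) = (3 : ℕ) by norm_num,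
            ENNReal.rpow_natCast, ← ENNReal.ofReal_pow (by positivity)]
          refine ENNReal.ofReal_le_ofReal ?_
          have h1 : (tCoord x.fst)⁻¹ ≤ 2 ^ (j + 1) := by
            rw [inv_le_comm₀ ht (by positivity)]
            simpa using hx.1.1.le
          calc (tCoord x.fst)⁻¹ ^ 3 ≤ (2 ^ (j + 1)) ^ 3 := by gcongr
            _ = 8 ^ (j + 1) := by rw [← pow_mul, mul_comm, pow_mul]; norm_num
      _ = ENNReal.ofReal (8 ^ (j + 1)) * Measure.hausdorffMeasure 3 (B j) := setLIntegral_const _ _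
      _ ≤ ENNReal.ofReal (8 ^ (j + 1)) * ENNReal.ofReal (1024 / 16 ^ j) := by
          gcongr
          refine (measure_mono fun x hx => ?_).trans (hausdorffMeasure_cuspPart_le j)
          refine ⟨?_, hx.2⟩
          simpa using hx.1.2
      _ = ENNReal.ofReal (8192 * (1 / 2) ^ j) := by
          rw [← ENNReal.ofReal_mul (by positivity)]
          congr 1
          rw [show (16 : ℝ) = 8 * 2 by norm_num, mul_pow, div_pow, one_pow, pow_succ]
          field_simp
          norm_num
  have hcover : ∀ x, x ∉ {x : X | tCoord x.fst = 0} ∪ ⋃ j, B j → g x = 0 := by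
    intro x hx
    simp only [mem_union, mem_iUnion, not_or, not_exists] at hx
    by_cases hxs : tCoord x.fst ∈ slitCoords
    · simp [g, invOff, hxs]
    · exfalso
      have ht : 0 < tCoord x.fst := lt_of_le_of_ne (tCoord_nonneg _) fun h => hx.1 h.symm
      obtain ⟨j, hj⟩ := exists_nat_pow_near_of_lt_one ht (tCoord_lt_one x.fst).le
        (y := (1 / 2 : ℝ)) (by norm_num) (by norm_num)
      exact hx.2 j ⟨hj, hxs⟩
  have hsplit : ∫⁻ x, g x ∂(Measure.hausdorffMeasure 3) =
      ∫⁻ x in {x : X | tCoord x.fst = 0} ∪ ⋃ j, B j, g x ∂(Measure.hausdorffMeasure 3) := by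
    have hm0 : MeasurableSet {x : X | tCoord x.fst = 0} := hmeas (measurableSet_singleton 0)
    rw [← lintegral_indicator (hm0.union (.iUnion hBm))]
    refine lintegral_congr fun x => ?_
    by_cases hx : x ∈ {x : X | tCoord x.fst = 0} ∪ ⋃ j, B j
    · rw [indicator_of_mem hx]
    · rw [indicator_of_notMem hx, hcover x hx]
  rw [hsplit]
  refine (lintegral_union_le _ _ _).trans_lt ?_
  rw [setLIntegral_measure_zero _ _ hausdorffMeasure_tCoord_eq_zero, zero_add]
  refine (lintegral_iUnion_le _ _).trans_lt ((ENNReal.tsum_le_tsum hBle).trans_lt ?_)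
  rw [← ENNReal.ofReal_tsum_of_nonneg (fun _ => by positivity)
    (summable_geometric_two.mul_left 8192)]
  exact ENNReal.ofReal_lt_top

end CuspSpace

/-! ### The collapsing map -/

namespace CuspSpace

open Filter Topology

theorem edist_collapse (x y : X) : edist (collapse x) (collapse y) =
    edist (CollapseQuotient.mk E x) (CollapseQuotient.mk E y) :=
  (isLengthSpace_X.collapseQuotient (E := E)).lengthEDist_eq _ _

theorem collapse_surjective : Function.Surjective collapse := by
  rintro ⟨z⟩
  obtain ⟨x, rfl⟩ := CollapseQuotient.mk_surjective E z
  exact ⟨x, rfl⟩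

theorem lipschitzWith_collapse : LipschitzWith 1 collapse := fun x y => by
  rw [edist_collapse, ENNReal.coe_one, one_mul]
  exact CollapseQuotient.edist_mk_le E x y

theorem tCoord_fst_of_mem_E {x : X} (hx : x ∈ E) : tCoord x.fst = 0 := tCoord_eq_zero_iff.2 hx.1

theorem continuous_fst_X : Continuous fun x : X => x.fst :=
  LipschitzWith.continuous (K := 1) fun x y => by
    rw [ENNReal.coe_one, one_mul]
    exact WithLp.edist_fst_le x y

theorem continuous_snd_X : Continuous fun x : X => x.snd :=
  LipschitzWith.continuous (K := 1) fun x y => by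
    rw [ENNReal.coe_one, one_mul]
    exact WithLp.edist_snd_le x y

theorem isClosed_E : IsClosed E :=
  (isClosed_singleton.preimage continuous_fst_X).inter
    (isClosed_Icc.preimage (continuous_subtype_val.comp continuous_snd_X))

theorem hausdorffMeasure_E : Measure.hausdorffMeasure 3 E = 0 :=
  measure_mono_null (fun _ hx => tCoord_fst_of_mem_E hx) hausdorffMeasure_tCoord_eq_zero

theorem collapse_eq_iff {x y : X} : collapse x = collapse y ↔ x = y ∨ (x ∈ E ∧ y ∈ E) := by
  rw [← CollapseQuotient.mk_eq_iff isClosed_E, ← edist_eq_zero, edist_collapse, edist_eq_zero]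

theorem not_injective_collapse : ¬ Function.Injective collapse := by
  intro h
  have h0 : WithLp.toLp 2 (cusp, (⟨0, by norm_num⟩ : Ioo (-2 : ℝ) 2)) ∈ E := ⟨rfl, by simp⟩
  have h1 : WithLp.toLp 2 (cusp, (⟨1, by norm_num⟩ : Ioo (-2 : ℝ) 2)) ∈ E := ⟨rfl, by simp⟩
  have := congrArg (fun x : X => (x.snd : ℝ)) (h (collapse_eq_iff.2 (Or.inr ⟨h0, h1⟩)))
  simp at this

theorem nonempty_E : E.Nonempty :=
  ⟨WithLp.toLp 2 (cusp, (⟨0, by norm_num⟩ : Ioo (-2 : ℝ) 2)), rfl, by simp⟩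

theorem edist_collapse_eq {x y : X} (h : edist x y ≤ Metric.infEDist x E + Metric.infEDist y E) :
    edist (collapse x) (collapse y) = edist x y := by
  rw [edist_collapse, CollapseQuotient.edist_mk_eq h]

theorem edist_collapse_eq_of_lt {x y : X}
    (h : edist (collapse x) (collapse y) < Metric.infEDist x E + Metric.infEDist y E) :
    edist (collapse x) (collapse y) = edist x y := by
  refine edist_collapse_eq ?_
  have := CollapseQuotient.le_edist_mk E x y
  rw [← edist_collapse] at this
  rcases min_le_iff.1 this with h' | h'
  · exact h'.trans h.le
  · exact absurd h h'.not_gt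

theorem infEDist_E_pos {x : X} (hx : x ∈ Eᶜ) : 0 < Metric.infEDist x E := by
  rw [Metric.infEDist_pos_iff_notMem_closure, isClosed_E.closure_eq]
  exact hx

theorem isLocalIsometryOn_collapse : IsLocalIsometryOn collapse Eᶜ := by
  intro x hx
  set r := min 1 (Metric.infEDist x E) with hr
  have hr0 : 0 < r := lt_min one_pos (infEDist_E_pos hx)
  have hrt : r ≠ ∞ := ((min_le_left _ _).trans_lt ENNReal.one_lt_top).ne
  refine ⟨Metric.eball x (r / 3), Metric.eball_mem_nhds x (by simpa using hr0.ne'), ?_⟩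
  intro p hp q hq
  rw [Metric.mem_eball] at hp hq
  refine edist_collapse_eq ?_
  have h3 : r = r / 3 + r / 3 + r / 3 := (ENNReal.add_thirds r).symm
  have hE : ∀ p : X, edist p x < r / 3 → r / 3 ≤ Metric.infEDist p E := by
    intro p hp
    by_contra! hlt
    have : r ≤ edist x p + Metric.infEDist p E :=
      (min_le_right _ _).trans Metric.infEDist_le_edist_add_infEDist
    rw [edist_comm] at this
    have h2 : r < r / 3 + r / 3 + r / 3 :=
      (this.trans_lt (ENNReal.add_lt_add hp hlt)).trans_le le_self_add
    exact h2.ne h3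
  calc edist p q ≤ edist p x + edist x q := edist_triangle _ _ _
    _ ≤ r / 3 + r / 3 := by
        rw [edist_comm x q]
        exact add_le_add hp.le hq.le
    _ ≤ _ := add_le_add (hE p hp) (hE q hq)

/-- The restriction of the quotient map to the complement of `E`. -/
noncomputable def collapseOff (x : (Eᶜ : Set X)) : XTilde := collapse x

theorem isOpenEmbedding_collapseOff : IsOpenEmbedding collapseOff := by
  refine .of_continuous_injective_isOpenMap
    (lipschitzWith_collapse.continuous.comp continuous_subtype_val) ?_ ?_
  · intro x y h
    rcases collapse_eq_iff.1 h with h | h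
    · exact Subtype.ext h
    · exact absurd h.1 x.2
  · refine isOpenMap_iff_nhds_le.2 fun x s hs => ?_
    obtain ⟨ε, hε, hs⟩ := EMetric.mem_nhds_iff.1 hs
    refine EMetric.mem_nhds_iff.2 ⟨min ε (Metric.infEDist x.1 E),
      lt_min hε (infEDist_E_pos x.2), fun z hz => ?_⟩
    obtain ⟨y, rfl⟩ := collapse_surjective z
    rw [Metric.mem_eball, edist_comm] at hz
    have hlt : edist (collapse x) (collapse y) < Metric.infEDist x.1 E :=
      hz.trans_le (min_le_right _ _)
    have heq := edist_collapse_eq_of_lt (hlt.trans_le le_self_add)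
    have hyE : y ∉ E := fun hy => by
      rw [heq] at hlt
      exact hlt.not_ge (Metric.infEDist_le_edist_of_mem hy)
    have hmem : (⟨y, hyE⟩ : (Eᶜ : Set X)) ∈ Metric.eball x ε := by
      rw [Metric.mem_eball, edist_comm]
      change edist x.1 y < ε
      rw [← heq]
      exact hz.trans_le (min_le_left _ _)
    exact hs hmem

theorem measurableEmbedding_collapseOff : MeasurableEmbedding collapseOff :=
  isOpenEmbedding_collapseOff.measurableEmbedding

/-- The coordinate `t` on the collapsed space.  It does not depend on the preimage that is used to
define it, see `tCoordTilde_collapse`. -/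
noncomputable def tCoordTilde (z : XTilde) : ℝ :=
  tCoord (Function.surjInv collapse_surjective z).fst

/-- Jumps within `E` are free, but `t` vanishes on `E`. -/
theorem edist_tCoord_le_edist_collapse (x y : X) :
    edist (tCoord x.fst) (tCoord y.fst) ≤ edist (collapse x) (collapse y) := by
  rw [edist_collapse, CollapseQuotient.edist_mk]
  refine edist_le_chainEDist (φ := fun x : X => tCoord x.fst) (fun x y => ?_) x y
  refine le_min (by simpa using lipschitzWith_tCoord_fst x y) (le_iInf fun h => ?_)
  rw [tCoord_fst_of_mem_E h.1, tCoord_fst_of_mem_E h.2, edist_self]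

theorem lipschitzWith_tCoordTilde : LipschitzWith 1 tCoordTilde := fun z w => by
  have h := edist_tCoord_le_edist_collapse (Function.surjInv collapse_surjective z)
    (Function.surjInv collapse_surjective w)
  rw [Function.surjInv_eq collapse_surjective, Function.surjInv_eq collapse_surjective] at h
  rwa [ENNReal.coe_one, one_mul]

theorem tCoordTilde_collapse (x : X) : tCoordTilde (collapse x) = tCoord x.fst := by
  have h := edist_tCoord_le_edist_collapse (Function.surjInv collapse_surjective (collapse x)) x
  rw [Function.surjInv_eq collapse_surjective, edist_self] at h
  exact edist_le_zero.1 h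

/-- On the set of points at a definite distance from `E`, both the quotient map and its inverse
preserve small distances; hence the quotient map preserves Hausdorff measure off `E`. -/
theorem hausdorffMeasure_collapse_image {d : ℝ} (hd : 0 ≤ d) {A : Set X} (hA : A ⊆ Eᶜ) :
    Measure.hausdorffMeasure d (collapse '' A) = Measure.hausdorffMeasure d A := by
  set U : ℕ → Set X := fun n => {x | ((n : ℝ≥0∞) + 1)⁻¹ ≤ Metric.infEDist x E} with hU
  have hpos : ∀ n : ℕ, 0 < ((n : ℝ≥0∞) + 1)⁻¹ := fun n => by
    simp [ENNReal.add_eq_top]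
  have hUm : Monotone U := fun m n hmn x hx => by
    refine le_trans ?_ (show ((m : ℝ≥0∞) + 1)⁻¹ ≤ Metric.infEDist x E from hx)
    gcongr
  have hAU : ⋃ n, A ∩ U n = A := by
    rw [← inter_iUnion, inter_eq_left]
    intro x hx
    obtain ⟨n, hn⟩ := ENNReal.exists_inv_nat_lt (infEDist_E_pos (hA hx)).ne'
    refine mem_iUnion.2 ⟨n, le_trans ?_ hn.le⟩
    gcongr
    exact le_self_add
  have hmono : Monotone fun n => A ∩ U n := fun m n hmn => inter_subset_inter_right _ (hUm hmn)
  have hdist : ∀ n, ∀ x ∈ U n, ∀ y ∈ U n,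
      ((n : ℝ≥0∞) + 1)⁻¹ ≤ Metric.infEDist x E + Metric.infEDist y E := fun n x hx y hy =>
    le_trans hx le_self_add
  refine le_antisymm ?_ ?_
  · have : collapse '' A = ⋃ n, collapse '' (A ∩ U n) := by rw [← image_iUnion, hAU]
    rw [this, Monotone.measure_iUnion fun m n hmn => image_mono (hmono hmn)]
    refine iSup_le fun n => (hausdorffMeasure_image_le_of_edist_le hd (hpos n) ?_).trans
      (measure_mono inter_subset_left)
    intro x hx y hy hxy
    exact (edist_collapse_eq (hxy.trans (hdist n x hx.2 y hy.2))).le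
  · nth_rw 1 [← hAU]
    rw [hmono.measure_iUnion]
    refine iSup_le fun n => ?_
    have hinv : ∀ x ∈ A ∩ U n, Function.surjInv collapse_surjective (collapse x) = x := by
      intro x hx
      rcases collapse_eq_iff.1 (Function.surjInv_eq collapse_surjective (collapse x)) with h | h
      · exact h
      · exact absurd h.2 (hA hx.1)
    have himage : A ∩ U n =
        Function.surjInv collapse_surjective '' (collapse '' (A ∩ U n)) := by
      rw [image_image]
      exact ((image_congr hinv).trans (image_id' _)).symm
    rw [himage]
    refine (hausdorffMeasure_image_le_of_edist_le hd (hpos n) ?_).trans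
      (measure_mono (image_mono inter_subset_left))
    rintro _ ⟨x, hx, rfl⟩ _ ⟨y, hy, rfl⟩ hxy
    rw [hinv x hx, hinv y hy]
    have hlt : ((n : ℝ≥0∞) + 1)⁻¹ < ((n : ℝ≥0∞) + 1)⁻¹ + ((n : ℝ≥0∞) + 1)⁻¹ :=
      ENNReal.lt_add_right (by simp) (hpos n).ne'
    exact (edist_collapse_eq_of_lt (hxy.trans_lt
      (hlt.trans_le (add_le_add hx.2 hy.2)))).ge

theorem measurePreserving_collapse :
    MeasurePreserving collapse (Measure.hausdorffMeasure 3) (Measure.hausdorffMeasure 3) := by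
  refine ⟨lipschitzWith_collapse.continuous.measurable, Measure.ext fun B hB => ?_⟩
  have hm := lipschitzWith_collapse.continuous.measurable
  obtain ⟨e, he⟩ := nonempty_E
  have : Measure.hausdorffMeasure 3 ({collapse e} : Set XTilde) = 0 :=
    (Measure.nullSingletonClass_hausdorff XTilde (by norm_num : (0 : ℝ) < 3)).measure_singleton _
  rw [Measure.map_apply hm hB, ← measure_sdiff_null hausdorffMeasure_E,
    ← hausdorffMeasure_collapse_image (by norm_num) (sdiff_subset_compl _ _),
    ← measure_sdiff_null (s := B) this]
  congr 1
  ext z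
  obtain ⟨x, rfl⟩ := collapse_surjective z
  constructor
  · rintro ⟨y, ⟨hy, hyE⟩, hyx⟩
    rw [← hyx]
    refine ⟨hy, fun h => ?_⟩
    rcases collapse_eq_iff.1 h with h | h
    · exact hyE (h ▸ he)
    · exact hyE h.1
  · rintro ⟨hx, hxe⟩
    exact ⟨x, ⟨hx, fun hxE => hxe (collapse_eq_iff.2 (Or.inr ⟨hxE, he⟩))⟩, rfl⟩

end CuspSpace

/-! ### Comparison of moduli -/

/-- If an arbitrarily small multiple of a fixed function of finite energy has to be added to `ρ`
to make it admissible, then the modulus is still at most the energy of `ρ`. -/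
theorem modulus_le_of_isAdmissible_max {Z : Type*} [EMetricSpace Z] [MeasurableSpace Z]
    [BorelSpace Z] {n p : ℝ} (hp : 0 < p) {Γ : Set (Curve Z)} {ρ g : Z → ℝ≥0∞} (hρ : Measurable ρ)
    (hg : ∫⁻ z, g z ^ p ∂(Measure.hausdorffMeasure n) ≠ ∞)
    (h : ∀ ε : ℝ≥0∞, ε ≠ 0 → ε ≠ ∞ → IsAdmissible Γ fun z => max (ρ z) (ε * g z)) :
    modulus n p Γ ≤ ∫⁻ z, ρ z ^ p ∂(Measure.hausdorffMeasure n) := by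
  set G := ∫⁻ z, g z ^ p ∂(Measure.hausdorffMeasure n) with hG
  have key : ∀ δ : ℝ≥0∞, δ ≠ 0 → δ ≠ ∞ → modulus n p Γ ≤
      ∫⁻ z, ρ z ^ p ∂(Measure.hausdorffMeasure n) + δ * G := by
    intro δ hδ hδ'
    have hε := ENNReal.rpow_inv_rpow hp.ne' δ
    have h' := h (δ ^ p⁻¹) (by simp [hδ, hp.le]) (by simp [hδ', hp.le])
    refine (iInf₂_le _ h').trans ?_
    rw [hG, ← lintegral_const_mul' _ _ hδ', ← lintegral_add_left (hρ.pow_const p)]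
    refine lintegral_mono fun z => ?_
    rcases max_choice (ρ z) (δ ^ p⁻¹ * g z) with hm | hm <;> simp only [hm]
    · exact le_self_add
    · rw [ENNReal.mul_rpow_of_nonneg _ _ hp.le, hε]
      exact le_add_self
  refine le_of_forall_gt_imp_ge_of_dense fun c hc => ?_
  by_cases hG0 : G = 0
  · have := key 1 one_ne_zero ENNReal.one_ne_top
    rw [hG0, mul_zero, add_zero] at this
    exact this.trans hc.le
  · obtain ⟨δ, hδ, hδc⟩ := ENNReal.exists_pos_mul_lt hg (tsub_pos_iff_lt.2 hc).ne'
    refine (key δ hδ.ne' ?_).trans ?_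
    · rintro rfl
      rw [ENNReal.top_mul hG0] at hδc
      exact not_top_lt hδc
    · calc _ ≤ _ + (c - ∫⁻ z, ρ z ^ p ∂(Measure.hausdorffMeasure n)) := by gcongr
        _ = c := add_tsub_cancel_of_le hc.le

namespace CuspSpace

theorem isLocallyRectifiable_map_collapse_of_disjoint {hc : Continuous collapse} {γ : Curve X}
    (h : Disjoint γ.trace E) :
    (γ.map collapse hc).IsLocallyRectifiable ↔ γ.IsLocallyRectifiable :=
  isLocalIsometryOn_collapse.isLocallyRectifiable_map h.subset_compl_right

theorem lineIntegral_map_collapse_of_disjoint {hc : Continuous collapse} {γ : Curve X}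
    (h : Disjoint γ.trace E) (ρ : XTilde → ℝ≥0∞) :
    (γ.map collapse hc).lineIntegral ρ = γ.lineIntegral (ρ ∘ collapse) :=
  isLocalIsometryOn_collapse.lineIntegral_map h.subset_compl_right ρ

theorem one_le_lineIntegral_max_of_meets {Z : Type*} [EMetricSpace Z] {u : Z → ℝ}
    (hu : LipschitzWith 1 u) (hu0 : ∀ z, 0 ≤ u z) {γ : Curve Z} (hγ : γ.IsLocallyRectifiable)
    (hmeet : ∃ z ∈ γ.trace, u z = 0) (hnt : ¬ γ.IsTrivial) (ρ : Z → ℝ≥0∞) {ε : ℝ≥0∞} (hε : ε ≠ 0)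
    (hε' : ε ≠ ∞) : 1 ≤ γ.lineIntegral fun z => max (ρ z) (ε * invOff slitCoords (u z)) := by
  refine le_trans ?_ (γ.lineIntegral_mono (ρ := fun z => ε * invOff slitCoords (u z))
    fun z => le_max_right _ _)
  rw [γ.lineIntegral_const_mul_eq_top (Curve.lineIntegral_invOff_eq_top countable_slitCoords
    zero_notMem_slitCoords hu hu0 hγ hmeet hnt) hε hε']
  exact le_top

/-- A density on `X` is transplanted to the collapsed space with value `0` at the point to which
`E` is collapsed. -/
theorem modulus_map_collapse_le (hc : Continuous collapse) (Γ : Set (Curve X)) :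
    modulus 3 3 (Curve.map collapse hc '' {γ ∈ Γ | γ.trace ⊆ E → γ.IsTrivial}) ≤
      modulus 3 3 Γ := by
  refine le_iInf₂ fun ρ hρ => ?_
  set σ : XTilde → ℝ≥0∞ := Function.extend collapseOff (fun x => ρ x) fun _ => 0 with hσ
  have hσm : Measurable σ := measurableEmbedding_collapseOff.measurable_extend
    (hρ.1.comp measurable_subtype_coe) measurable_const
  have hσρ : ∀ x ∉ E, σ (collapse x) = ρ x := fun x hx =>
    isOpenEmbedding_collapseOff.injective.extend_apply (fun x : (Eᶜ : Set X) => ρ x) _ ⟨x, hx⟩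
  have hg : ∫⁻ z, invOff slitCoords (tCoordTilde z) ^ (3 : ℝ)
      ∂(Measure.hausdorffMeasure 3) ≠ ∞ := by
    have hm : Measurable fun z => invOff slitCoords (tCoordTilde z) ^ (3 : ℝ) :=
      ((measurable_invOff countable_slitCoords).comp
        lipschitzWith_tCoordTilde.continuous.measurable).pow_const _
    rw [← measurePreserving_collapse.lintegral_comp hm]
    simp only [tCoordTilde_collapse]
    exact lintegral_invOff_tCoord_lt_top.ne
  have henergy : ∫⁻ z, σ z ^ (3 : ℝ) ∂(Measure.hausdorffMeasure 3) =
      ∫⁻ x, ρ x ^ (3 : ℝ) ∂(Measure.hausdorffMeasure 3) := by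
    rw [← measurePreserving_collapse.lintegral_comp (hσm.pow_const _)]
    refine lintegral_congr_ae ?_
    filter_upwards [measure_eq_zero_iff_ae_notMem.1 hausdorffMeasure_E] with x hx
    rw [hσρ x hx]
  rw [← henergy]
  refine modulus_le_of_isAdmissible_max (by norm_num) hσm hg fun ε hε hε' => ⟨?_, ?_⟩
  · exact hσm.max (((measurable_invOff countable_slitCoords).comp
      lipschitzWith_tCoordTilde.continuous.measurable).const_mul ε)
  rintro _ ⟨γ, ⟨hγΓ, hγE⟩, rfl⟩ hrect
  by_cases hdisj : Disjoint γ.trace E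
  · rw [isLocallyRectifiable_map_collapse_of_disjoint hdisj] at hrect
    rw [lineIntegral_map_collapse_of_disjoint hdisj]
    refine (hρ.2 γ hγΓ hrect).trans ((le_of_eq ?_).trans (γ.lineIntegral_mono
      (ρ := σ ∘ collapse) fun x => le_max_left _ _))
    exact Curve.lineIntegral_congr hrect fun x hx => (hσρ x (disjoint_left.1 hdisj hx)).symm
  obtain ⟨x, hx, hxE⟩ := not_disjoint_iff.1 hdisj
  by_cases htriv : γ.IsTrivial
  · -- a constant curve in `Γ` contradicts the admissibility of `ρ`
    have := hρ.2 γ hγΓ (Curve.isLocallyRectifiable_of_isTrivial htriv)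
    rw [Curve.lineIntegral_eq_zero_of_isTrivial htriv] at this
    simp at this
  have hmap : collapse x ∈ (γ.map collapse hc).trace := by
    obtain ⟨s, hs, rfl⟩ := hx
    exact ⟨s, hs, rfl⟩
  refine one_le_lineIntegral_max_of_meets lipschitzWith_tCoordTilde (fun z => tCoord_nonneg _) hrect
    ⟨_, hmap, by rw [tCoordTilde_collapse, tCoord_fst_of_mem_E hxE]⟩ (fun ht => ?_) σ hε hε'
  refine htriv (hγE fun y hy => ?_)
  have hmap' : collapse y ∈ (γ.map collapse hc).trace := by
    obtain ⟨s, hs, rfl⟩ := hy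
    exact ⟨s, hs, rfl⟩
  rcases collapse_eq_iff.1 (ht hmap' hmap) with h | h
  · exact h ▸ hxE
  · exact h.1

/-- A density on the collapsed space is pulled back to `X`.  The nonconstant curves inside
`E`, whose images have been left out, are among the negligible curves that meet `E`. -/
theorem le_modulus_map_collapse (hc : Continuous collapse) (Γ : Set (Curve X)) :
    modulus 3 3 Γ ≤
      modulus 3 3 (Curve.map collapse hc '' {γ ∈ Γ | γ.trace ⊆ E → γ.IsTrivial}) := by
  refine le_iInf₂ fun σ hσ => ?_
  rw [← measurePreserving_collapse.lintegral_comp (hσ.1.pow_const _)]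
  have hσm : Measurable (σ ∘ collapse) := hσ.1.comp hc.measurable
  refine modulus_le_of_isAdmissible_max (by norm_num) hσm lintegral_invOff_tCoord_lt_top.ne
    fun ε hε hε' => ⟨?_, ?_⟩
  · exact hσm.max (((measurable_invOff countable_slitCoords).comp
      lipschitzWith_tCoord_fst.continuous.measurable).const_mul ε)
  intro γ hγΓ hrect
  by_cases htriv : γ.IsTrivial
  · -- the image of a constant curve is constant, and contradicts the admissibility of `σ`
    have htriv' : (γ.map collapse hc).IsTrivial := by
      rintro _ ⟨s, hs, rfl⟩ _ ⟨t, ht, rfl⟩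
      exact congrArg collapse (htriv ⟨s, hs, rfl⟩ ⟨t, ht, rfl⟩)
    have := hσ.2 _ ⟨γ, ⟨hγΓ, fun _ => htriv⟩, rfl⟩ (Curve.isLocallyRectifiable_of_isTrivial htriv')
    rw [Curve.lineIntegral_eq_zero_of_isTrivial htriv'] at this
    simp at this
  by_cases hdisj : Disjoint γ.trace E
  · have hmem : γ ∈ {γ ∈ Γ | γ.trace ⊆ E → γ.IsTrivial} := by
      refine ⟨hγΓ, fun hsub => absurd (hdisj.mono_right hsub) ?_⟩
      obtain ⟨s, hs⟩ := γ.dom_nonempty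
      exact not_disjoint_iff.2 ⟨_, ⟨s, hs, rfl⟩, ⟨s, hs, rfl⟩⟩
    have h := hσ.2 _ ⟨γ, hmem, rfl⟩ ((isLocallyRectifiable_map_collapse_of_disjoint hdisj).2 hrect)
    rw [lineIntegral_map_collapse_of_disjoint hdisj] at h
    exact h.trans (γ.lineIntegral_mono fun x => le_max_left _ _)
  · obtain ⟨x, hx, hxE⟩ := not_disjoint_iff.1 hdisj
    exact one_le_lineIntegral_max_of_meets lipschitzWith_tCoord_fst (fun z => tCoord_nonneg _) hrect
      ⟨x, hx, tCoord_fst_of_mem_E hxE⟩ htriv (σ ∘ collapse) hε hε'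

end CuspSpace

theorem mainTheorem2 :
    ∃ hc : Continuous CuspSpace.collapse,
      Function.Surjective CuspSpace.collapse ∧ ¬ IsHomeomorph CuspSpace.collapse ∧
      (∀ Γ : Set (Curve CuspSpace.X),
        (∀ γ ∈ Γ, γ.trace ⊆ CuspSpace.E → γ.IsTrivial) →
          modulus 3 3 (Curve.map CuspSpace.collapse hc '' Γ) = modulus 3 3 Γ) ∧
      (∀ Γ : Set (Curve CuspSpace.X),
        modulus 3 3 (Curve.map CuspSpace.collapse hc ''
          {γ ∈ Γ | γ.trace ⊆ CuspSpace.E → γ.IsTrivial}) = modulus 3 3 Γ) := by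
  have hc := CuspSpace.lipschitzWith_collapse.continuous
  have key := fun Γ => le_antisymm (CuspSpace.modulus_map_collapse_le hc Γ)
    (CuspSpace.le_modulus_map_collapse hc Γ)
  refine ⟨hc, CuspSpace.collapse_surjective, fun h => CuspSpace.not_injective_collapse h.injective,
    fun Γ hΓ => ?_, key⟩
  have h := key Γ
  rwa [sep_eq_self_iff_mem_true.2 hΓ] at h
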